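/- Let $\mathbb F_q$ be a finite field, $A=\mathbb F_q[T]$, $k$ a finite extension of $\mathbb F_q$, and $k\{\tau\}$ the ring of twisted polynomials with $\tau\alpha=\alpha^q\tau$ for $\alpha\in k$. Let $\phi:A\to k\{\tau\}$, $a\mapsto\phi_a$, be a Drinfeld module, i.e. an injective homomorphism of $\mathbb F_q$-algebras, let $r=\deg_\tau(\phi_T)$ be its rank, and let its characteristic $\mathfrak p\in A$ be the minimal polynomial over $\mathbb F_q$ of the degree zero coefficient of $\phi_T$. For a monic irreducible $\mathfrak l\in A$ let $A_{\mathfrak l}$ be the completion of $A$ at $\mathfrak l$ and $T_{\mathfrak l}(\phi)=\varprojlim_n\phi[\mathfrak l^n]$ the Tate module, where $\phi[a]$ is the set of roots in $\overline k$ of the $q$-polynomial $\phi_a(x)$ and the transition maps are given by $\phi_{\mathfrak l}$. Let $u\in\operatorname{End}(\phi)=\{u\in k\{\tau\}: u\phi_T=\phi_Tu\}$ be separable, i.e. its degree zero coefficient is nonzero. For every monic irreducible $\mathfrak l\neq\mathfrak p$ the $A_{\mathfrak l}$-module $T_{\mathfrak l}(\phi)$ is free of rank $r$, and the characteristic polynomial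 and the determinant of $u$ acting on it are the images of elements $P_{\phi,u}(T,x)\in A[x]$ and $\det(u)\in A$ which are unique and independent of $\mathfrak l$. They satisfy $$\deg P_{\phi,u}(T,0)=\deg\det(u)=\deg_\tau(u).$$ -/

import Mathlib

noncomputable section

namespace Drinfeld

open Multiplicative

/-! ### Twisted polynomials `k{τ}` -/

/-- The field `k`, regarded as a coefficient ring on which `m : Multiplicative ℕ` acts through the
`m`-th power of the `q`-Frobenius `a ↦ a ^ q`, where `q = #Fq`. -/
def Coeff (Fq k : Type*) [Field Fq] [Fintype Fq] [Field k] [Algebra Fq k] : Type _ := k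

section Twisted

variable (Fq k : Type*) [Field Fq] [Fintype Fq] [Field k] [Algebra Fq k]

instance : Field (Coeff Fq k) := inferInstanceAs (Field k)

instance : Algebra Fq (Coeff Fq k) := inferInstanceAs (Algebra Fq k)

instance : MulSemiringAction (Multiplicative ℕ) (Coeff Fq k) where
  smul m a := ((FiniteField.frobeniusAlgHom Fq (Coeff Fq k)) ^ toAdd m) a
  one_smul _ := rfl
  mul_smul m n a := by
    change ((FiniteField.frobeniusAlgHom Fq (Coeff Fq k)) ^ toAdd (m * n)) a =
      ((FiniteField.frobeniusAlgHom Fq (Coeff Fq k)) ^ toAdd m)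
        (((FiniteField.frobeniusAlgHom Fq (Coeff Fq k)) ^ toAdd n) a)
    rw [toAdd_mul, pow_add, AlgHom.mul_apply]
  smul_zero _ := map_zero _
  smul_add _ := map_add _
  smul_one _ := map_one _
  smul_mul _ := map_mul _

theorem coeff_smul_def (m : Multiplicative ℕ) (a : Coeff Fq k) :
    m • a = a ^ (Fintype.card Fq ^ toAdd m) := by
  change ((FiniteField.frobeniusAlgHom Fq (Coeff Fq k)) ^ toAdd m) a = _
  induction toAdd m with
  | zero => simp
  | succ n ih =>
    rw [pow_succ', AlgHom.mul_apply, ih, FiniteField.coe_frobeniusAlgHom]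
    exact (pow_mul a _ _).symm.trans (by rw [pow_succ])

instance : SMulCommClass (Multiplicative ℕ) Fq (Coeff Fq k) where
  smul_comm m c a := map_smul ((FiniteField.frobeniusAlgHom Fq (Coeff Fq k)) ^ toAdd m) c a

/-- The twisted polynomial ring `k{τ}`, with `τ a = a ^ q τ` for `a ∈ k`. It is an
`Fq`-algebra. -/
abbrev TwistedPolynomial : Type _ := SkewPolynomial (Coeff Fq k)

/-- The defining relation of `k{τ}`. -/
theorem tau_mul_C (a : Coeff Fq k) :
    (SkewPolynomial.X * SkewPolynomial.C a : TwistedPolynomial Fq k) =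
      SkewPolynomial.C (a ^ Fintype.card Fq) * SkewPolynomial.X := by
  have h : SkewPolynomial.φ a = a ^ Fintype.card Fq := by
    change ofAdd 1 • a = _
    rw [coeff_smul_def]
    simp
  rw [SkewPolynomial.X, SkewPolynomial.monomial_mul_C, SkewPolynomial.C_mul_monomial]
  simp [h]

variable {Fq k}

/-- The degree in `τ` of a twisted polynomial, with the convention `deg 0 = ⊥`. -/
def tauDegree (u : TwistedPolynomial Fq k) : WithBot ℕ := (SkewPolynomial.support u).max

/-- A twisted polynomial is separable if its degree zero coefficient is nonzero. -/
def IsSeparable (u : TwistedPolynomial Fq k) : Prop := SkewPolynomial.coeff u 0 ≠ 0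

variable (Fq k)

theorem frobenius_pow_apply (n : ℕ) (z : AlgebraicClosure k) :
    ((FiniteField.frobeniusAlgHom Fq (AlgebraicClosure k)).toLinearMap ^ n :
      Module.End Fq (AlgebraicClosure k)) z = z ^ (Fintype.card Fq ^ n) := by
  induction n with
  | zero => simp
  | succ n ih =>
    rw [pow_succ', Module.End.mul_apply, ih, AlgHom.toLinearMap_apply,
      FiniteField.coe_frobeniusAlgHom]
    exact (pow_mul z _ _).symm.trans (by rw [pow_succ])

/-- The ring homomorphism sending `u = ∑ aᵢ τⁱ` to the `Fq`-linear map
`x ↦ u(x) = ∑ aᵢ x ^ (q ^ i)` on the algebraic closure of `k`. -/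
def evalHom : TwistedPolynomial Fq k →+* Module.End Fq (AlgebraicClosure k) :=
  SkewMonoidAlgebra.liftNCRingHom
    ((Algebra.lmul Fq (AlgebraicClosure k) : AlgebraicClosure k →+* _).comp
      (algebraMap k (AlgebraicClosure k)))
    (powersHom _ (FiniteField.frobeniusAlgHom Fq (AlgebraicClosure k)).toLinearMap)
    (by
      intro x m
      ext z
      rw [coeff_smul_def]
      change algebraMap k (AlgebraicClosure k) ((x : k) ^ (Fintype.card Fq ^ toAdd m)) *
        ((powersHom _ _ m : Module.End Fq (AlgebraicClosure k)) z) =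
        (powersHom _ _ m : Module.End Fq (AlgebraicClosure k)) (algebraMap k _ x * z)
      simp only [powersHom_apply, frobenius_pow_apply, mul_pow]
      exact congrArg (· * _) (map_pow (algebraMap k (AlgebraicClosure k)) _ _))

theorem evalHom_monomial (n : ℕ) (a : Coeff Fq k) (x : AlgebraicClosure k) :
    evalHom Fq k (SkewPolynomial.monomial n a) x =
      algebraMap k (AlgebraicClosure k) a * x ^ (Fintype.card Fq ^ n) := by
  rw [← frobenius_pow_apply Fq k n x]
  exact LinearMap.congr_fun (SkewMonoidAlgebra.liftNC_single _ _ _ _) x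

theorem evalHom_apply (u : TwistedPolynomial Fq k) (x : AlgebraicClosure k) :
    evalHom Fq k u x = ∑ i ∈ SkewPolynomial.support u,
      algebraMap k (AlgebraicClosure k) (SkewPolynomial.coeff u i) *
        x ^ (Fintype.card Fq ^ i) := by
  conv_lhs => rw [← SkewPolynomial.sum_monomial u, SkewPolynomial.sum_def]
  rw [map_sum, LinearMap.sum_apply]
  exact Finset.sum_congr rfl fun i _ => evalHom_monomial Fq k i _ x

end Twisted

/-! ### Tate modules -/

section Tate

variable {R : Type*} [CommRing R] (l : R) (M : Type*) [AddCommGroup M] [Module R M]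

/-- The inverse limit of the torsion submodules `M[lⁿ]` along multiplication by `l`, as the
module of compatible sequences `(xₙ)` with `xₙ ∈ M[lⁿ]` and `l xₙ₊₁ = xₙ`. -/
def tateSubmodule : Submodule R (ℕ → M) where
  carrier := {x | ∀ n, x n ∈ Submodule.torsionBy R M (l ^ n) ∧ l • x (n + 1) = x n}
  zero_mem' n := ⟨zero_mem _, smul_zero _⟩
  add_mem' hx hy n := ⟨add_mem (hx n).1 (hy n).1, by
    simp only [Pi.add_apply, smul_add, (hx n).2, (hy n).2]⟩
  smul_mem' c x hx n := ⟨Submodule.smul_mem _ c (hx n).1, by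
    simp only [Pi.smul_apply, smul_comm l c, (hx n).2]⟩

/-- The `l`-adic Tate module of `M`. -/
abbrev TateModule : Type _ := tateSubmodule l M

/-- The completion of `R` at the ideal generated by `l`. -/
abbrev Completion : Type _ := AdicCompletion (Ideal.span {l}) R

variable {l M}

theorem pow_smul_coord (x : TateModule l M) (n : ℕ) : l ^ n • x.1 n = 0 :=
  (Submodule.mem_torsionBy_iff _ _).1 (x.2 n).1

theorem ideal_le_ker (x : TateModule l M) (n : ℕ) :
    (Ideal.span {l} ^ n • ⊤ : Submodule R R) ≤
      LinearMap.ker (LinearMap.toSpanSingleton R M (x.1 n)) := by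
  intro r hr
  rw [smul_eq_mul, Ideal.mul_top, Ideal.span_singleton_pow, Ideal.mem_span_singleton] at hr
  obtain ⟨s, rfl⟩ := hr
  rw [LinearMap.mem_ker, LinearMap.toSpanSingleton_apply, mul_comm, mul_smul, pow_smul_coord,
    smul_zero]

/-- The `n`-th coordinate of `a x`: the class of `a` in `R / lⁿ` acts on `xₙ ∈ M[lⁿ]`. -/
def smulCoord (a : Completion l) (x : TateModule l M) (n : ℕ) : M :=
  Submodule.liftQ _ (LinearMap.toSpanSingleton R M (x.1 n)) (ideal_le_ker x n) (a.1 n)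

theorem smulCoord_eq (a : Completion l) (x : TateModule l M) (n : ℕ) (r : R)
    (h : a.1 n = Submodule.Quotient.mk r) : smulCoord a x n = r • x.1 n := by
  rw [smulCoord, h, Submodule.liftQ_apply, LinearMap.toSpanSingleton_apply]

theorem exists_rep (a : Completion l) (n : ℕ) :
    ∃ r : R, ∀ m ≤ n, a.1 m = Submodule.Quotient.mk r := by
  obtain ⟨r, hr⟩ := Submodule.Quotient.mk_surjective _ (a.1 n)
  refine ⟨r, fun m hm => ?_⟩
  rw [← a.2 hm, ← hr]
  rfl

instance : SMul (Completion l) (TateModule l M) where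
  smul a x := ⟨smulCoord a x, fun n => by
    obtain ⟨r, hr⟩ := exists_rep a (n + 1)
    rw [smulCoord_eq a x n r (hr n n.le_succ), smulCoord_eq a x (n + 1) r (hr _ le_rfl)]
    exact ⟨Submodule.smul_mem _ r (x.2 n).1, by rw [smul_comm, (x.2 n).2]⟩⟩

theorem smul_coord (a : Completion l) (x : TateModule l M) (n : ℕ) (r : R)
    (h : a.1 n = Submodule.Quotient.mk r) : (a • x).1 n = r • x.1 n :=
  smulCoord_eq a x n r h

instance : Module (Completion l) (TateModule l M) where
  one_smul x := by
    ext n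
    rw [smul_coord 1 x n 1 rfl, one_smul]
  mul_smul a b x := by
    ext n
    obtain ⟨r, hr⟩ := exists_rep a n
    obtain ⟨s, hs⟩ := exists_rep b n
    rw [smul_coord a _ n r (hr n le_rfl), smul_coord b x n s (hs n le_rfl),
      smul_coord (a * b) x n (r * s)
        (by rw [AdicCompletion.val_mul, hr n le_rfl, hs n le_rfl]; rfl), mul_smul]
  smul_zero a := by
    ext n
    obtain ⟨r, hr⟩ := exists_rep a n
    rw [smul_coord a _ n r (hr n le_rfl)]
    exact smul_zero r
  smul_add a x y := by
    ext n
    obtain ⟨r, hr⟩ := exists_rep a n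
    change _ = (a • x).1 n + (a • y).1 n
    rw [smul_coord a _ n r (hr n le_rfl), smul_coord a _ n r (hr n le_rfl),
      smul_coord a _ n r (hr n le_rfl)]
    exact smul_add r _ _
  add_smul a b x := by
    ext n
    obtain ⟨r, hr⟩ := exists_rep a n
    obtain ⟨s, hs⟩ := exists_rep b n
    change _ = (a • x).1 n + (b • x).1 n
    rw [smul_coord a _ n r (hr n le_rfl), smul_coord b x n s (hs n le_rfl),
      smul_coord (a + b) x n (r + s)
        (by change a.1 n + b.1 n = _; rw [hr n le_rfl, hs n le_rfl]; rfl), add_smul]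
  zero_smul x := by
    ext n
    rw [smul_coord 0 x n 0 rfl]
    exact zero_smul R _

/-- The `R`-module structure on the Tate module is induced by the one over the completion. -/
instance : IsScalarTower R (Completion l) (TateModule l M) where
  smul_assoc c a x := by
    ext n
    obtain ⟨r, hr⟩ := exists_rep a n
    change _ = c • (a • x).1 n
    rw [smul_coord a _ n r (hr n le_rfl), smul_coord (c • a) x n (c • r)
      (by change c • a.1 n = _; rw [hr n le_rfl]; rfl), smul_assoc]

variable (l)

/-- The endomorphism of the Tate module induced, coordinate by coordinate, by an endomorphism
of `M`. -/
def tateMap (f : M →ₗ[R] M) : TateModule l M →ₗ[Completion l] TateModule l M where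
  toFun x := ⟨fun n => f (x.1 n), fun n =>
    ⟨by rw [Submodule.mem_torsionBy_iff, ← map_smul, pow_smul_coord, map_zero],
      by rw [← map_smul, (x.2 n).2]⟩⟩
  map_add' x y := by
    ext n
    exact map_add f _ _
  map_smul' a x := by
    ext n
    obtain ⟨r, hr⟩ := exists_rep a n
    rw [RingHom.id_apply, smul_coord a _ n r (hr n le_rfl)]
    change f ((a • x).1 n) = _
    rw [smul_coord a _ n r (hr n le_rfl), map_smul]

end Tate

end Drinfeld

/-! ### Drinfeld modules -/

/-- A Drinfeld module over `k`: an injective morphism of `Fq`-algebras `Fq[T] → k{τ}`. -/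
structure DrinfeldModule (Fq k : Type*) [Field Fq] [Fintype Fq] [Field k] [Algebra Fq k] where
  toAlgHom : Polynomial Fq →ₐ[Fq] Drinfeld.TwistedPolynomial Fq k
  injective : Function.Injective toAlgHom

namespace DrinfeldModule

open Drinfeld

variable {Fq k : Type*} [Field Fq] [Fintype Fq] [Field k] [Algebra Fq k]
variable (φ : DrinfeldModule Fq k)

/-- The rank of `φ`, i.e. the degree in `τ` of `φ_T`. -/
def rank : ℕ := (tauDegree (φ.toAlgHom Polynomial.X)).unbotD 0

/-- The characteristic of `φ`: the minimal polynomial over `Fq` of the degree zero coefficient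
of `φ_T`. -/
def characteristic : Polynomial Fq :=
  minpoly Fq (SkewPolynomial.coeff (φ.toAlgHom Polynomial.X) 0)

/-- The endomorphism ring of `φ`: the elements of `k{τ}` commuting with `φ_T`. -/
abbrev End : Subring (TwistedPolynomial Fq k) :=
  Subring.centralizer {φ.toAlgHom Polynomial.X}

/-- The algebraic closure of `k`, as an `Fq[T]`-module through `a • x = φ_a(x)`. -/
def Points (_φ : DrinfeldModule Fq k) : Type _ := AlgebraicClosure k

instance : AddCommGroup φ.Points := inferInstanceAs (AddCommGroup (AlgebraicClosure k))

instance : Module (Polynomial Fq) φ.Points :=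
  Module.compHom (AlgebraicClosure k) ((evalHom Fq k).comp (φ.toAlgHom : Polynomial Fq →+* _))

theorem smul_points (a : Polynomial Fq) (x : φ.Points) :
    a • x = (evalHom Fq k (φ.toAlgHom a) (x : AlgebraicClosure k) : AlgebraicClosure k) :=
  rfl

theorem End.commute (u : φ.End) (a : Polynomial Fq) :
    φ.toAlgHom a * u.1 = u.1 * φ.toAlgHom a := by
  have h : φ.toAlgHom Polynomial.X * u.1 = u.1 * φ.toAlgHom Polynomial.X :=
    Subring.mem_centralizer_iff.1 u.2 _ rfl
  induction a using Polynomial.induction_on' with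
  | add p q hp hq => rw [map_add, add_mul, mul_add, hp, hq]
  | monomial n c =>
    rw [← Polynomial.C_mul_X_pow_eq_monomial, map_mul, map_pow, ← Polynomial.algebraMap_eq,
      AlgHom.commutes]
    have h1 : Commute (φ.toAlgHom Polynomial.X ^ n) u.1 := Commute.pow_left h n
    exact Commute.mul_left (Algebra.commutes c u.1) h1

/-- An endomorphism `u` of `φ` acts `Fq[T]`-linearly on the points by `x ↦ u(x)`. -/
def endPoints (u : φ.End) : φ.Points →ₗ[Polynomial Fq] φ.Points where
  toFun x := evalHom Fq k u.1 x
  map_add' x y := map_add (evalHom Fq k u.1) x y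
  map_smul' a x := by
    have h : evalHom Fq k u.1 * evalHom Fq k (φ.toAlgHom a) =
        evalHom Fq k (φ.toAlgHom a) * evalHom Fq k u.1 := by
      rw [← map_mul, ← map_mul, End.commute]
    exact LinearMap.congr_fun h x

/-- `P` is the characteristic polynomial `P_{φ,u}(T, x) ∈ Fq[T][x]` of the endomorphism `u`:
for every monic irreducible `l` other than the characteristic of `φ`, the Tate module at `l` is
free of rank `φ.rank` over the completion of `Fq[T]` at `l`, and the characteristic polynomial
of `u` on it is (the image of) `P`. -/
def IsCharpoly (u : φ.End) (P : Polynomial (Polynomial Fq)) : Prop :=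
  ∀ l : Polynomial Fq, l.Monic → Irreducible l → l ≠ φ.characteristic →
    ∃ b : Module.Basis (Fin φ.rank) (Completion l) (TateModule l φ.Points),
      (LinearMap.toMatrix b b (tateMap l (φ.endPoints u))).charpoly =
        P.map (algebraMap (Polynomial Fq) (Completion l))

/-- `D` is the determinant `det(u) ∈ Fq[T]` of the endomorphism `u`: for every monic irreducible
`l` other than the characteristic of `φ`, the Tate module at `l` is free of rank `φ.rank` over
the completion of `Fq[T]` at `l`, and the determinant of `u` on it is (the image of) `D`. -/
def IsDet (u : φ.End) (D : Polynomial Fq) : Prop :=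
  ∀ l : Polynomial Fq, l.Monic → Irreducible l → l ≠ φ.characteristic →
    ∃ b : Module.Basis (Fin φ.rank) (Completion l) (TateModule l φ.Points),
      (LinearMap.toMatrix b b (tateMap l (φ.endPoints u))).det =
        algebraMap (Polynomial Fq) (Completion l) D

end DrinfeldModule

end

/-! Let `Φ = φ_T`. The ring `k{τ}` becomes a `k[T]`-module when `k` acts on the left and `T` by
right multiplication by `Φ`. Since `τ^j Φ^s` has `τ`-degree `j + r s`, division with remainder shows
that it is free with basis `1, τ, …, τ^(r-1)` (`comb_injective`, `exists_comb`). Right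
multiplication by `u` is `k[T]`-linear, with a matrix `U` in this basis (`coordMatrix`).

Three facts about `U` give the theorem. The degree in `T` of `det U` is the `τ`-degree of `u`: in
the Leibniz formula exactly one permutation has top degree (`det_degree_of_tight`,
`degree_det_coordMatrix`). The characteristic polynomial of `U` has coefficients in `Fq[T]`: left
multiplication by `τ` is Frobenius-semilinear, injective and commutes with right multiplication by
`u`, so over `k(T)` it conjugates `U` to its Frobenius twist (`frobCoeff_charpoly`,
`exists_charpoly_coordMatrix`). Finally, this polynomial is the one of `u` on each Tate module: for
`L = l^m` there is a pairing between `k{τ}` and `φ[L]` with values in `k̄[T]/L`, under which right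
multiplication by `u` corresponds to the action of `u` on points. Its Gram matrix is invertible
(`isUnit_pairingMatrix`), so the two characteristic polynomials agree modulo `l^m` for every `m`
(`dvd_coeff_charpoly_sub`, `isCharpoly_of_map_eq`). -/

open Polynomial

noncomputable section

namespace Drinfeld

/-! ### `q`-polynomials and the degree in `τ` -/

section Degree

variable {Fq k : Type*} [Field Fq] [Fintype Fq] [Field k] [Algebra Fq k]

theorem one_lt_card_Fq (Fq : Type*) [Field Fq] [Fintype Fq] : 1 < Fintype.card Fq :=
  Fintype.one_lt_card

theorem card_pow_injective (Fq : Type*) [Field Fq] [Fintype Fq] :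
    Function.Injective (fun n : ℕ => Fintype.card Fq ^ n) :=
  Nat.pow_right_injective (one_lt_card_Fq Fq)

theorem card_pow_strictMono (Fq : Type*) [Field Fq] [Fintype Fq] :
    StrictMono (fun n : ℕ => Fintype.card Fq ^ n) :=
  fun _ _ h => Nat.pow_lt_pow_right (one_lt_card_Fq Fq) h

variable (Fq k) in
/-- The embedding of `k` in its algebraic closure, on coefficients of twisted polynomials. -/
def coeffEmb : Coeff Fq k →+* AlgebraicClosure k := algebraMap k (AlgebraicClosure k)

theorem coeffEmb_injective : Function.Injective (coeffEmb Fq k) :=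
  (algebraMap k (AlgebraicClosure k)).injective

/-- The `q`-polynomial `∑ aᵢ x ^ (q ^ i)` attached to `∑ aᵢ τⁱ`. -/
def linPoly (w : TwistedPolynomial Fq k) : (AlgebraicClosure k)[X] :=
  ∑ i ∈ SkewPolynomial.support w,
    monomial (Fintype.card Fq ^ i) (coeffEmb Fq k (SkewPolynomial.coeff w i))

theorem eval_linPoly (w : TwistedPolynomial Fq k) (x : AlgebraicClosure k) :
    (linPoly w).eval x = evalHom Fq k w x := by
  rw [linPoly, evalHom_apply, eval_finsetSum]
  simp only [eval_monomial]
  rfl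

theorem coeff_linPoly (w : TwistedPolynomial Fq k) (n : ℕ) :
    (linPoly w).coeff (Fintype.card Fq ^ n) =
      coeffEmb Fq k (SkewPolynomial.coeff w n) := by
  rw [linPoly, finsetSum_coeff, Finset.sum_eq_single n]
  · simp
  · intro m _ hm
    rw [coeff_monomial, if_neg fun h => hm (card_pow_injective Fq h)]
  · intro h
    rw [SkewPolynomial.notMem_support_iff] at h
    rw [h, map_zero, monomial_zero_right, Polynomial.coeff_zero]

theorem linPoly_add (v w : TwistedPolynomial Fq k) : linPoly (v + w) = linPoly v + linPoly w := by
  refine Polynomial.funext fun x => ?_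
  rw [eval_add, eval_linPoly, eval_linPoly, eval_linPoly, map_add, LinearMap.add_apply]

variable (Fq k) in
/-- `linPoly` as an additive map. -/
def linPolyHom : TwistedPolynomial Fq k →+ (AlgebraicClosure k)[X] :=
  AddMonoidHom.mk' linPoly linPoly_add

/-- Polynomials over the infinite field `k̄` are determined by their values, and on values `evalHom`
is a ring homomorphism. -/
theorem linPoly_mul (v w : TwistedPolynomial Fq k) :
    linPoly (v * w) = (linPoly v).comp (linPoly w) := by
  refine Polynomial.funext fun x => ?_
  rw [eval_comp, eval_linPoly, eval_linPoly, eval_linPoly, map_mul, Module.End.mul_apply]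

theorem linPoly_eq_zero {w : TwistedPolynomial Fq k} : linPoly w = 0 ↔ w = 0 := by
  refine ⟨fun h => ?_, fun h => h ▸ rfl⟩
  ext n
  have := coeff_linPoly w n
  rw [h, Polynomial.coeff_zero] at this
  exact coeffEmb_injective (this.symm.trans (map_zero _).symm)

theorem tauDegree_zero : tauDegree (0 : TwistedPolynomial Fq k) = ⊥ := rfl

theorem tauDegree_eq_bot {w : TwistedPolynomial Fq k} : tauDegree w = ⊥ ↔ w = 0 := by
  rw [tauDegree, Finset.max_eq_bot, SkewPolynomial.support_eq_empty]

/-- As `n ↦ q^n` is strictly increasing, statements about ordinary degrees transfer to `τ`-degrees.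
-/
theorem degree_linPoly (w : TwistedPolynomial Fq k) :
    (linPoly w).degree = (tauDegree w).map (fun n => Fintype.card Fq ^ n) := by
  by_cases hw : w = 0
  · subst hw
    rfl
  obtain ⟨n, hn⟩ := WithBot.ne_bot_iff_exists.1 (mt tauDegree_eq_bot.1 hw)
  rw [← hn, WithBot.map_coe]
  have hmem : n ∈ SkewPolynomial.support w := Finset.mem_of_max hn.symm
  refine le_antisymm ?_ ?_
  · refine (degree_sum_le _ _).trans (Finset.sup_le fun i hi => ?_)
    refine (degree_monomial_le _ _).trans ?_
    have : i ≤ n := WithBot.coe_le_coe.1 ((Finset.le_max hi).trans hn.ge)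
    exact WithBot.coe_le_coe.2 ((card_pow_strictMono Fq).monotone this)
  · refine le_degree_of_ne_zero ?_
    rw [SkewPolynomial.mem_support_iff] at hmem
    change (linPoly w).coeff (Fintype.card Fq ^ n) ≠ 0
    rw [coeff_linPoly]
    exact fun h => hmem (coeffEmb_injective (h.trans (map_zero _).symm))

theorem withBot_map_card_strictMono (Fq : Type*) [Field Fq] [Fintype Fq] :
    StrictMono (WithBot.map fun n : ℕ => Fintype.card Fq ^ n) :=
  (card_pow_strictMono Fq).withBot_map

/-- Degrees multiply under composition of `q`-polynomials, so their exponents in base `q` add. -/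
theorem tauDegree_mul (v w : TwistedPolynomial Fq k) :
    tauDegree (v * w) = tauDegree v + tauDegree w := by
  by_cases hv : v = 0
  · simp [hv, tauDegree_zero]
  by_cases hw : w = 0
  · simp [hw, tauDegree_zero]
  obtain ⟨n, hn⟩ := WithBot.ne_bot_iff_exists.1 (mt tauDegree_eq_bot.1 hv)
  obtain ⟨m, hm⟩ := WithBot.ne_bot_iff_exists.1 (mt tauDegree_eq_bot.1 hw)
  apply (withBot_map_card_strictMono Fq).injective
  have h1 := degree_linPoly v
  have h2 := degree_linPoly w
  rw [← hn, WithBot.map_coe] at h1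
  rw [← hm, WithBot.map_coe] at h2
  have h3 : ((linPoly v).comp (linPoly w)).natDegree = Fintype.card Fq ^ (n + m) := by
    rw [natDegree_comp, natDegree_eq_of_degree_eq_some h1, natDegree_eq_of_degree_eq_some h2,
      pow_add]
    rfl
  rw [← degree_linPoly, linPoly_mul, ← hn, ← hm, ← WithBot.coe_add, WithBot.map_coe, ← h3]
  refine degree_eq_natDegree fun h => ?_
  rw [h, natDegree_zero] at h3
  exact (pow_pos (zero_lt_one.trans (one_lt_card_Fq Fq)) _).ne h3

theorem tauDegree_sum_eq_of_disjoint {ι : Type*} (f : ι → TwistedPolynomial Fq k) (s : Finset ι)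
    (h : Set.Pairwise {i | i ∈ s ∧ f i ≠ 0} (Function.onFun Ne (tauDegree ∘ f))) :
    tauDegree (∑ i ∈ s, f i) = s.sup fun i => tauDegree (f i) := by
  apply (withBot_map_card_strictMono Fq).injective
  rw [← degree_linPoly]
  change (linPolyHom Fq k (∑ i ∈ s, f i)).degree = _
  rw [map_sum, degree_sum_eq_of_disjoint (fun i => linPolyHom Fq k (f i))]
  · rw [Finset.apply_sup_eq_sup_comp_of_linearOrder _ (withBot_map_card_strictMono Fq).monotone rfl]
    exact Finset.sup_congr rfl fun i _ => degree_linPoly (f i)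
  · rintro i ⟨hi, hi0⟩ j ⟨hj, hj0⟩ hij
    have := h ⟨hi, fun e => hi0 (linPoly_eq_zero.2 e)⟩ ⟨hj, fun e => hj0 (linPoly_eq_zero.2 e)⟩ hij
    intro e
    refine this ((withBot_map_card_strictMono Fq).injective ?_)
    exact (degree_linPoly (f i)).symm.trans (e.trans (degree_linPoly (f j)))

theorem tauDegree_X_pow (n : ℕ) :
    tauDegree (SkewPolynomial.X ^ n : TwistedPolynomial Fq k) = n := by
  rw [tauDegree, SkewPolynomial.support_X_pow, Finset.max_singleton]
  rfl

theorem tauDegree_C {a : Coeff Fq k} (ha : a ≠ 0) :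
    tauDegree (SkewPolynomial.C a : TwistedPolynomial Fq k) = 0 := by
  rw [tauDegree, SkewPolynomial.support_C ha, Finset.max_singleton]
  rfl

theorem twisted_smul_eq (a : Coeff Fq k) (w : TwistedPolynomial Fq k) :
    a • w = SkewPolynomial.C a * w := by
  induction w using SkewPolynomial.induction with
  | h0 => simp
  | ha n b w _ _ ih =>
    rw [smul_add, mul_add, ih, SkewPolynomial.smul_monomial, SkewPolynomial.C_mul_monomial,
      smul_eq_mul]

theorem tauDegree_smul {a : Coeff Fq k} (ha : a ≠ 0) (w : TwistedPolynomial Fq k) :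
    tauDegree (a • w) = tauDegree w := by
  rw [twisted_smul_eq, tauDegree_mul, tauDegree_C ha, zero_add]

end Degree

/-! ### The `k[T]`-module structure on `k{τ}` -/

section Motive

variable {Fq k : Type*} [Field Fq] [Fintype Fq] [Field k] [Algebra Fq k]

/-- Right multiplication by `v`, as a `k`-linear endomorphism of `k{τ}`. -/
def mulRight (v : TwistedPolynomial Fq k) :
    Module.End (Coeff Fq k) (TwistedPolynomial Fq k) where
  toFun w := w * v
  map_add' _ _ := add_mul _ _ _
  map_smul' a w := by simp only [twisted_smul_eq, mul_assoc, RingHom.id_apply]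

theorem mulRight_apply (v w : TwistedPolynomial Fq k) : mulRight v w = w * v := rfl

theorem mulRight_pow_apply (v w : TwistedPolynomial Fq k) (n : ℕ) :
    (mulRight v ^ n) w = w * v ^ n := by
  induction n generalizing w with
  | zero => simp
  | succ n ih => rw [pow_succ, Module.End.mul_apply, ih, mulRight_apply, pow_succ', mul_assoc]

/-- The action of `k[T]` on `k{τ}` for which `T` acts by right multiplication by `Φ`. -/
def act (Φ : TwistedPolynomial Fq k) (p : (Coeff Fq k)[X]) :
    Module.End (Coeff Fq k) (TwistedPolynomial Fq k) :=
  aeval (mulRight Φ) p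

theorem act_add (Φ : TwistedPolynomial Fq k) (p p' : (Coeff Fq k)[X])
    (w : TwistedPolynomial Fq k) : act Φ (p + p') w = act Φ p w + act Φ p' w := by
  rw [act, map_add]; rfl

theorem act_zero (Φ w : TwistedPolynomial Fq k) : act Φ 0 w = 0 := by
  rw [act, map_zero]; rfl

theorem act_mul (Φ : TwistedPolynomial Fq k) (p p' : (Coeff Fq k)[X])
    (w : TwistedPolynomial Fq k) : act Φ (p * p') w = act Φ p (act Φ p' w) := by
  rw [act, map_mul]; rfl

theorem act_eq_sum (Φ : TwistedPolynomial Fq k) (p : (Coeff Fq k)[X])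
    (w : TwistedPolynomial Fq k) :
    act Φ p w = ∑ s ∈ p.support, p.coeff s • (w * Φ ^ s) := by
  rw [act, aeval_def, eval₂_eq_sum, Polynomial.sum, LinearMap.sum_apply]
  refine Finset.sum_congr rfl fun s _ => ?_
  rw [Module.End.mul_apply, mulRight_pow_apply, Module.algebraMap_end_apply]

theorem act_monomial (Φ : TwistedPolynomial Fq k) (s : ℕ) (a : Coeff Fq k)
    (w : TwistedPolynomial Fq k) : act Φ (monomial s a) w = a • (w * Φ ^ s) := by
  rw [act, aeval_monomial, Module.End.mul_apply, mulRight_pow_apply, Module.algebraMap_end_apply]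

theorem act_mul_right {Φ u : TwistedPolynomial Fq k} (hu : Commute Φ u) (p : (Coeff Fq k)[X])
    (w : TwistedPolynomial Fq k) : act Φ p w * u = act Φ p (w * u) := by
  simp only [act_eq_sum, twisted_smul_eq, Finset.sum_mul, mul_assoc, (hu.pow_left _).eq]

/-- Left multiplication by `τ` commutes with `T` and raises scalars of `k` to the `q`-th power. -/
theorem X_mul_act (Φ : TwistedPolynomial Fq k) (p : (Coeff Fq k)[X])
    (w : TwistedPolynomial Fq k) :
    SkewPolynomial.X * act Φ p w =
      act Φ (p.map (FiniteField.frobeniusAlgHom Fq (Coeff Fq k) : Coeff Fq k →+* Coeff Fq k))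
        (SkewPolynomial.X * w) := by
  induction p using Polynomial.induction_on' with
  | add p p' h h' => rw [act_add, mul_add, h, h', Polynomial.map_add, act_add]
  | monomial s a =>
    rw [Polynomial.map_monomial, act_monomial, act_monomial, twisted_smul_eq, twisted_smul_eq,
      ← mul_assoc, tau_mul_C]
    simp only [mul_assoc]
    rfl

theorem tauDegree_pow (w : TwistedPolynomial Fq k) {r : ℕ} (h : tauDegree w = r) (n : ℕ) :
    tauDegree (w ^ n) = (r * n : ℕ) := by
  induction n with
  | zero =>
    rw [pow_zero, mul_zero, ← SkewPolynomial.C_1, tauDegree_C one_ne_zero]; rfl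
  | succ n ih => rw [pow_succ, tauDegree_mul, ih, h, mul_add, mul_one]; rfl

/-- The terms `w Φ^s` have distinct degrees `m + r s`, so nothing cancels. -/
theorem tauDegree_act {Φ : TwistedPolynomial Fq k} {r : ℕ} (hr : 0 < r) (hΦ : tauDegree Φ = r)
    {p : (Coeff Fq k)[X]} (hp : p ≠ 0) {w : TwistedPolynomial Fq k} {m : ℕ}
    (hw : tauDegree w = m) : tauDegree (act Φ p w) = (m + r * p.natDegree : ℕ) := by
  have key : ∀ s ∈ p.support, tauDegree (p.coeff s • (w * Φ ^ s)) = (m + r * s : ℕ) := by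
    intro s hs
    rw [tauDegree_smul (mem_support_iff.1 hs), tauDegree_mul, tauDegree_pow Φ hΦ, hw]
    rfl
  rw [act_eq_sum, tauDegree_sum_eq_of_disjoint]
  · rw [Finset.sup_congr rfl key]
    refine le_antisymm (Finset.sup_le fun s hs => ?_) ?_
    · exact WithBot.coe_le_coe.2 (by gcongr; exact le_natDegree_of_mem_supp s hs)
    · exact Finset.le_sup (f := fun s => ((m + r * s : ℕ) : WithBot ℕ))
        (natDegree_mem_support_of_nonzero hp)
  · rintro s ⟨hs, -⟩ s' ⟨hs', -⟩ hss e
    simp only [Function.comp_apply, key s hs, key s' hs'] at e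
    have : m + r * s = m + r * s' := WithBot.coe_injective e
    exact hss (Nat.eq_of_mul_eq_mul_left hr (by omega))

end Motive

/-! ### The basis `1, τ, …, τ^(r-1)` of `k{τ}` over `k[T]` -/

section Comb

variable {Fq k : Type*} [Field Fq] [Fintype Fq] [Field k] [Algebra Fq k]
variable (Φ : TwistedPolynomial Fq k) {r : ℕ}

theorem act_sum {ι : Type*} (s : Finset ι) (p : ι → (Coeff Fq k)[X])
    (w : TwistedPolynomial Fq k) : act Φ (∑ i ∈ s, p i) w = ∑ i ∈ s, act Φ (p i) w := by
  rw [act, map_sum, LinearMap.sum_apply]; rfl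

/-- The combination `∑ pⱼ τʲ` of `1, τ, …, τʳ⁻¹` with coefficients in `k[T]`. -/
def comb (p : Fin r → (Coeff Fq k)[X]) : TwistedPolynomial Fq k :=
  ∑ j, act Φ (p j) (SkewPolynomial.X ^ (j : ℕ))

theorem comb_add (p p' : Fin r → (Coeff Fq k)[X]) : comb Φ (p + p') = comb Φ p + comb Φ p' := by
  simp only [comb, Pi.add_apply, act_add, Finset.sum_add_distrib]

theorem comb_sub (p p' : Fin r → (Coeff Fq k)[X]) : comb Φ (p - p') = comb Φ p - comb Φ p' := by
  rw [eq_sub_iff_add_eq, ← comb_add, sub_add_cancel]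

theorem comb_single (j : Fin r) (p : (Coeff Fq k)[X]) :
    comb Φ (Pi.single j p) = act Φ p (SkewPolynomial.X ^ (j : ℕ)) := by
  rw [comb, Finset.sum_eq_single j]
  · rw [Pi.single_eq_same]
  · intro i _ hi
    rw [Pi.single_eq_of_ne hi, act_zero]
  · exact fun h => absurd (Finset.mem_univ _) h

theorem comb_vecMul {s : ℕ} (p : Fin s → (Coeff Fq k)[X])
    (M : Matrix (Fin s) (Fin r) (Coeff Fq k)[X]) :
    comb Φ (Matrix.vecMul p M) = ∑ j, act Φ (p j) (comb Φ (M j)) := by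
  simp only [comb, Matrix.vecMul, dotProduct, act_sum, map_sum, act_mul]
  exact Finset.sum_comm

variable {Φ}

theorem tauDegree_comb_term (hr : 0 < r) (hΦ : tauDegree Φ = r) {p : Fin r → (Coeff Fq k)[X]}
    {j : Fin r} (hj : p j ≠ 0) :
    tauDegree (act Φ (p j) (SkewPolynomial.X ^ (j : ℕ))) = (j + r * (p j).natDegree : ℕ) :=
  tauDegree_act hr hΦ hj (tauDegree_X_pow j)

theorem fin_eq_of_add_mul_eq {i j : Fin r} {a b : ℕ} (h : (i : ℕ) + r * a = j + r * b) :
    i = j := by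
  have := congrArg (· % r) h
  simp only [Nat.add_mul_mod_self_left, Nat.mod_eq_of_lt i.2, Nat.mod_eq_of_lt j.2] at this
  exact Fin.ext this

/-- The `j`-th term has degree congruent to `j` modulo `r`; hence the nonzero terms have distinct
degrees. Linear independence follows. -/
theorem tauDegree_comb (hr : 0 < r) (hΦ : tauDegree Φ = r) (p : Fin r → (Coeff Fq k)[X]) :
    tauDegree (comb Φ p) =
      Finset.univ.sup fun j => tauDegree (act Φ (p j) (SkewPolynomial.X ^ (j : ℕ))) := by
  refine tauDegree_sum_eq_of_disjoint _ _ ?_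
  rintro i ⟨-, hi⟩ j ⟨-, hj⟩ hij e
  have hi' : p i ≠ 0 := fun h => hi (by rw [h, act_zero])
  have hj' : p j ≠ 0 := fun h => hj (by rw [h, act_zero])
  simp only [Function.comp_apply, tauDegree_comb_term hr hΦ hi',
    tauDegree_comb_term hr hΦ hj'] at e
  exact hij (fin_eq_of_add_mul_eq (WithBot.coe_injective e))

theorem comb_eq_zero (hr : 0 < r) (hΦ : tauDegree Φ = r) {p : Fin r → (Coeff Fq k)[X]}
    (h : comb Φ p = 0) : p = 0 := by
  funext j
  by_contra hj
  have h1 := tauDegree_comb hr hΦ p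
  rw [h, tauDegree_zero] at h1
  have h2 := (Finset.le_sup (f := fun j => tauDegree (act Φ (p j) (SkewPolynomial.X ^ (j : ℕ))))
    (Finset.mem_univ j)).trans h1.ge
  simp only [tauDegree_comb_term hr hΦ hj] at h2
  exact WithBot.coe_ne_bot (le_bot_iff.1 h2)

theorem comb_injective (hr : 0 < r) (hΦ : tauDegree Φ = r) :
    Function.Injective (comb Φ : (Fin r → (Coeff Fq k)[X]) → _) := fun p p' h =>
  sub_eq_zero.1 (comb_eq_zero hr hΦ (by rw [comb_sub, h, sub_self]))

theorem exists_smul_tauDegree_sub_lt {v w : TwistedPolynomial Fq k} {n : ℕ}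
    (hv : tauDegree v = n) (hw : tauDegree w = n) :
    ∃ a : Coeff Fq k, tauDegree (w - a • v) < n := by
  have hvn : SkewPolynomial.coeff v n ≠ 0 :=
    SkewPolynomial.mem_support_iff.1 (Finset.mem_of_max hv)
  refine ⟨SkewPolynomial.coeff w n / SkewPolynomial.coeff v n, ?_⟩
  refine (Finset.sup_lt_iff (WithBot.bot_lt_coe n)).2 fun m hm => ?_
  rw [SkewPolynomial.mem_support_iff, SkewPolynomial.coeff_sub] at hm
  have hsm : ∀ (a : Coeff Fq k), SkewPolynomial.coeff (a • v) m = a * SkewPolynomial.coeff v m :=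
    fun _ => rfl
  rw [hsm] at hm
  refine lt_of_not_ge fun hnm => hm ?_
  have hnm : n ≤ m := WithBot.coe_le_coe.1 hnm
  rcases hnm.eq_or_lt with rfl | hlt
  · rw [div_mul_cancel₀ _ hvn, sub_self]
  · have h0 : ∀ x : TwistedPolynomial Fq k, tauDegree x = n → SkewPolynomial.coeff x m = 0 := by
      intro x hx
      by_contra hc
      have := (Finset.le_max (SkewPolynomial.mem_support_iff.2 hc)).trans hx.le
      exact absurd (WithBot.coe_le_coe.1 this) (not_le.2 hlt)
    rw [h0 v hv, h0 w hw, mul_zero, sub_self]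

/-- Division algorithm: a scalar multiple of a module element of the same degree removes the leading
term. -/
theorem exists_comb (hr : 0 < r) (hΦ : tauDegree Φ = r) (w : TwistedPolynomial Fq k) :
    ∃ p : Fin r → (Coeff Fq k)[X], comb Φ p = w := by
  suffices H : ∀ n : ℕ, ∀ w : TwistedPolynomial Fq k, tauDegree w < n →
      ∃ p : Fin r → (Coeff Fq k)[X], comb Φ p = w by
    obtain ⟨n, hn⟩ : ∃ n : ℕ, tauDegree w < n := by
      rcases h : tauDegree w with _ | m
      · exact ⟨0, WithBot.bot_lt_coe 0⟩
      · exact ⟨m + 1, WithBot.coe_lt_coe.2 m.lt_succ_self⟩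
    exact H n w hn
  intro n
  induction n with
  | zero =>
    intro w hw
    have : w = 0 := tauDegree_eq_bot.1 ((Nat.WithBot.lt_zero_iff).1 hw)
    refine ⟨0, ?_⟩
    rw [this, comb]
    exact Finset.sum_eq_zero fun j _ => act_zero _ _
  | succ n ih =>
    intro w hw
    by_cases hn : tauDegree w < n
    · exact ih w hn
    have hwn : tauDegree w = n := by
      rcases h : tauDegree w with _ | m
      · exact absurd (h ▸ WithBot.bot_lt_coe n) hn
      · rw [h] at hw hn
        have h1 : m < n + 1 := WithBot.coe_lt_coe.1 hw
        have h2 : ¬ m < n := fun h => hn (WithBot.coe_lt_coe.2 h)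
        exact congrArg _ (by omega : m = n)
    -- Writing `n = n % r + r (n / r)`, the element `τ^(n % r) Φ^(n / r)` has degree exactly `n`.
    have hj : tauDegree (act Φ (monomial (n / r) (1 : Coeff Fq k))
        (SkewPolynomial.X ^ (n % r))) = n := by
      rw [tauDegree_act hr hΦ (by simp) (tauDegree_X_pow _), natDegree_monomial_eq _ one_ne_zero,
        Nat.mod_add_div]
    obtain ⟨a, ha⟩ := exists_smul_tauDegree_sub_lt hj hwn
    obtain ⟨p, hp⟩ := ih _ ha
    refine ⟨p + Pi.single (⟨n % r, Nat.mod_lt _ hr⟩ : Fin r) (C a * monomial (n / r) 1), ?_⟩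
    rw [comb_add, comb_single, hp, act_mul, show C a = monomial 0 a from rfl, act_monomial Φ 0 a, pow_zero,
      mul_one, sub_add_cancel]

/-- The matrix of coordinates in the basis `1, τ, …, τʳ⁻¹` of the elements `τⁱ w`. -/
def coordMatrix (hr : 0 < r) (hΦ : tauDegree Φ = r) (w : TwistedPolynomial Fq k) :
    Matrix (Fin r) (Fin r) (Coeff Fq k)[X] :=
  fun i => (exists_comb hr hΦ (SkewPolynomial.X ^ (i : ℕ) * w)).choose

theorem comb_coordMatrix (hr : 0 < r) (hΦ : tauDegree Φ = r) (w : TwistedPolynomial Fq k)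
    (i : Fin r) : comb Φ (coordMatrix hr hΦ w i) = SkewPolynomial.X ^ (i : ℕ) * w :=
  (exists_comb hr hΦ (SkewPolynomial.X ^ (i : ℕ) * w)).choose_spec

end Comb

/-! ### Matrix lemmas: conjugation and the degree of a determinant -/

section Det

theorem charpoly_eq_of_mul_eq {S n : Type*} [CommRing S] [Fintype n] [DecidableEq n]
    {U B W : Matrix n n S} (hB : IsUnit B) (h : U * B = B * W) : U.charpoly = W.charpoly := by
  obtain ⟨β, rfl⟩ := hB
  have h' : β.val * W * β⁻¹.val = U := by
    rw [← h, mul_assoc, Units.mul_inv, mul_one]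
  rw [← h', Matrix.coe_units_inv, Matrix.charpoly_units_conj]

/-- Give the entry `(i, j)` the weight `j + r deg U i j`. In row `i` the bound `i + d` is reached in
a single column `f i`, as the weight determines `j` modulo `r`, and `f` is a permutation for the
same reason. Summing the weights over the rows, the indices cancel: the product along `f` has degree
`d`, and along any other permutation less. -/
theorem det_degree_of_tight {K : Type*} [Field K] {r : ℕ} (hr : 0 < r) (d : ℕ)
    (U : Matrix (Fin r) (Fin r) K[X])
    (hle : ∀ i j, U i j ≠ 0 → (j : ℕ) + r * (U i j).natDegree ≤ i + d)
    (heq : ∀ i, ∃ j, U i j ≠ 0 ∧ (j : ℕ) + r * (U i j).natDegree = i + d) :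
    U.det.degree = d := by
  choose f hf0 hf using heq
  have hinj : Function.Injective f := by
    intro i i' h
    have h1 := hf i
    have h2 := hf i'
    rw [h] at h1
    have h3 : (i : ℕ) + r * (U i' (f i')).natDegree = i' + r * (U i (f i')).natDegree := by
      omega
    exact fin_eq_of_add_mul_eq h3
  let σ : Equiv.Perm (Fin r) := Equiv.ofBijective f (Finite.injective_iff_bijective.1 hinj)
  have hprod : ∀ π : Equiv.Perm (Fin r), (∀ i, U i (π i) ≠ 0) →
      (∏ i, U i (π i)).natDegree = ∑ i, (U i (π i)).natDegree := fun π hπ =>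
    natDegree_prod _ _ fun i _ => hπ i
  have hsum : ∀ π : Equiv.Perm (Fin r),
      (∑ i, ((π i : ℕ) + r * (U i (π i)).natDegree)) =
        (∑ i : Fin r, (i : ℕ)) + r * ∑ i, (U i (π i)).natDegree := fun π => by
    rw [Finset.sum_add_distrib, Finset.mul_sum, Equiv.sum_comp π (fun i : Fin r => (i : ℕ))]
  have hsum' : (∑ i : Fin r, ((i : ℕ) + d)) = (∑ i : Fin r, (i : ℕ)) + r * d := by
    rw [Finset.sum_add_distrib]
    simp
  have hσ : (∏ i, U i (σ i)).degree = d := by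
    have h0 : ∏ i, U i (σ i) ≠ 0 := Finset.prod_ne_zero_iff.2 fun i _ => hf0 i
    rw [degree_eq_natDegree h0, hprod σ hf0]
    have h1 : (∑ i, ((σ i : ℕ) + r * (U i (σ i)).natDegree)) = ∑ i : Fin r, ((i : ℕ) + d) :=
      Finset.sum_congr rfl fun i _ => hf i
    rw [hsum, hsum'] at h1
    exact congrArg _ (Nat.eq_of_mul_eq_mul_left hr (Nat.add_left_cancel h1))
  have hπ : ∀ π : Equiv.Perm (Fin r), π ≠ σ → (∏ i, U i (π i)).degree < d := by
    intro π hne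
    by_cases h0 : ∀ i, U i (π i) ≠ 0
    · have h0' : ∏ i, U i (π i) ≠ 0 := Finset.prod_ne_zero_iff.2 fun i _ => h0 i
      rw [degree_eq_natDegree h0', hprod π h0]
      obtain ⟨i, hi⟩ : ∃ i, π i ≠ σ i := by
        by_contra! h
        exact hne (Equiv.ext h)
      have h1 : (∑ i, ((π i : ℕ) + r * (U i (π i)).natDegree)) < ∑ i : Fin r, ((i : ℕ) + d) := by
        refine Finset.sum_lt_sum (fun j _ => hle _ _ (h0 j)) ⟨i, Finset.mem_univ i, ?_⟩
        refine lt_of_le_of_ne (hle _ _ (h0 i)) fun e => hi ?_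
        exact fin_eq_of_add_mul_eq (e.trans (hf i).symm)
      rw [hsum, hsum'] at h1
      exact WithBot.coe_lt_coe.2 (lt_of_mul_lt_mul_left (Nat.lt_of_add_lt_add_left h1) hr.le)
    · push Not at h0
      obtain ⟨i, hi⟩ := h0
      rw [Finset.prod_eq_zero (Finset.mem_univ i) hi, degree_zero]
      exact WithBot.bot_lt_coe d
  have hsign : ∀ (π : Equiv.Perm (Fin r)) (p : K[X]),
      (Equiv.Perm.sign π • p).degree = p.degree := by
    intro π p
    rcases Int.units_eq_one_or (Equiv.Perm.sign π) with h | h <;> rw [h] <;> simp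
  -- `Matrix.det_apply` runs over the entries `(π i, i)`; transposing turns them into `(i, π i)`.
  rw [← Matrix.det_transpose, Matrix.det_apply, ← Finset.add_sum_erase _ _ (Finset.mem_univ σ)]
  simp only [Matrix.transpose_apply]
  rw [degree_add_eq_left_of_degree_lt, hsign, hσ]
  rw [hsign, hσ]
  refine (degree_sum_le _ _).trans_lt ((Finset.sup_lt_iff (WithBot.bot_lt_coe d)).2 ?_)
  intro π h
  rw [hsign]
  exact hπ π (Finset.ne_of_mem_erase h)

end Det

/-! ### Degree of `det U` and descent of its characteristic polynomial to `Fq[T]` -/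

section CoordMatrix

variable {Fq k : Type*} [Field Fq] [Fintype Fq] [Field k] [Algebra Fq k]
variable {Φ : TwistedPolynomial Fq k} {r : ℕ} (hr : 0 < r) (hΦ : tauDegree Φ = r)

/-- The weights of row `i` are the degrees of the terms in the expansion of `τ^i w`, whose degree is
`i + d`. No commutation with `Φ` is needed, so this serves both for `u` and for `τ`. -/
theorem degree_det_coordMatrix {w : TwistedPolynomial Fq k} {d : ℕ} (hw : tauDegree w = d) :
    (coordMatrix hr hΦ w).det.degree = d := by
  have key : ∀ i : Fin r, Finset.univ.sup (fun j : Fin r =>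
      tauDegree (act Φ (coordMatrix hr hΦ w i j) (SkewPolynomial.X ^ (j : ℕ)))) =
        ((i + d : ℕ) : WithBot ℕ) := by
    intro i
    rw [← tauDegree_comb hr hΦ, comb_coordMatrix, tauDegree_mul, tauDegree_X_pow, hw]
    rfl
  refine det_degree_of_tight hr d _ (fun i j hij => ?_) fun i => ?_
  · have := (Finset.le_sup (f := fun j : Fin r => tauDegree (act Φ (coordMatrix hr hΦ w i j)
      (SkewPolynomial.X ^ (j : ℕ)))) (Finset.mem_univ j)).trans (key i).le
    simp only [tauDegree_comb_term hr hΦ hij] at this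
    exact WithBot.coe_le_coe.1 this
  · obtain ⟨j, -, hj⟩ := Finset.exists_mem_eq_sup Finset.univ ⟨i, Finset.mem_univ i⟩
      (fun j : Fin r => tauDegree (act Φ (coordMatrix hr hΦ w i j)
        (SkewPolynomial.X ^ (j : ℕ))))
    rw [key i] at hj
    have h0 : coordMatrix hr hΦ w i j ≠ 0 := by
      intro h
      rw [h, act_zero, tauDegree_zero] at hj
      exact WithBot.coe_ne_bot hj
    rw [tauDegree_comb_term hr hΦ h0] at hj
    exact ⟨j, h0, (WithBot.coe_injective hj).symm⟩

theorem comb_mul_of_commute {u : TwistedPolynomial Fq k} (hu : Commute Φ u)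
    (p : Fin r → (Coeff Fq k)[X]) :
    comb Φ p * u = comb Φ (Matrix.vecMul p (coordMatrix hr hΦ u)) := by
  rw [comb_vecMul, comb, Finset.sum_mul]
  exact Finset.sum_congr rfl fun j _ => by rw [act_mul_right hu, comb_coordMatrix]

variable (Fq k) in
/-- The `q`-Frobenius on the coefficients of polynomials over `k`. -/
def frobCoeff : (Coeff Fq k)[X] →+* (Coeff Fq k)[X] :=
  mapRingHom (FiniteField.frobeniusAlgHom Fq (Coeff Fq k) : Coeff Fq k →+* Coeff Fq k)

theorem X_mul_comb (p : Fin r → (Coeff Fq k)[X]) :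
    SkewPolynomial.X * comb Φ p =
      comb Φ (Matrix.vecMul (fun j => frobCoeff Fq k (p j))
        (coordMatrix hr hΦ SkewPolynomial.X)) := by
  rw [comb_vecMul, comb, Finset.mul_sum]
  refine Finset.sum_congr rfl fun j _ => ?_
  rw [X_mul_act, comb_coordMatrix, ← pow_succ', ← pow_succ]
  rfl

/-- Row `i` on both sides expands `τ^(i+1) u`, computed once as `τ (τ^i u)` and once as `(τ^i τ) u`.
-/
theorem frobCoeff_coordMatrix_mul {u : TwistedPolynomial Fq k} (hu : Commute Φ u) :
    (coordMatrix hr hΦ u).map (frobCoeff Fq k) * coordMatrix hr hΦ SkewPolynomial.X =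
      coordMatrix hr hΦ SkewPolynomial.X * coordMatrix hr hΦ u := by
  refine funext fun i => ?_
  rw [Matrix.mul_apply_eq_vecMul, Matrix.mul_apply_eq_vecMul]
  apply comb_injective hr hΦ
  rw [← comb_mul_of_commute hr hΦ hu, comb_coordMatrix, mul_assoc]
  change comb Φ (Matrix.vecMul (fun j => frobCoeff Fq k (coordMatrix hr hΦ u i j)) _) = _
  rw [← X_mul_comb, comb_coordMatrix, ← mul_assoc, ← mul_assoc, ← pow_succ, ← pow_succ']

/-- The matrix of `τ` has determinant of degree `1`, hence is invertible over the fraction field,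
where it conjugates `U` to its twist. -/
theorem frobCoeff_charpoly {u : TwistedPolynomial Fq k} (hu : Commute Φ u) :
    (coordMatrix hr hΦ u).charpoly.map (frobCoeff Fq k) = (coordMatrix hr hΦ u).charpoly := by
  let ι := algebraMap (Coeff Fq k)[X] (FractionRing (Coeff Fq k)[X])
  have hι : Function.Injective ι := IsFractionRing.injective _ _
  have hX : tauDegree (SkewPolynomial.X : TwistedPolynomial Fq k) = (1 : ℕ) := by
    simpa using tauDegree_X_pow (Fq := Fq) (k := k) 1
  have hdet : (coordMatrix hr hΦ SkewPolynomial.X).det ≠ 0 := by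
    intro h
    have := degree_det_coordMatrix hr hΦ hX
    rw [h, degree_zero] at this
    exact WithBot.bot_ne_coe this
  have hunit : IsUnit ((coordMatrix hr hΦ SkewPolynomial.X).map ι) := by
    rw [Matrix.isUnit_iff_isUnit_det, isUnit_iff_ne_zero]
    have : ((coordMatrix hr hΦ SkewPolynomial.X).map ι).det =
      ι (coordMatrix hr hΦ SkewPolynomial.X).det := (RingHom.map_det ι _).symm
    rw [this]
    exact (map_ne_zero_iff ι hι).2 hdet
  have h := congrArg (fun M => M.map ι) (frobCoeff_coordMatrix_mul hr hΦ hu)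
  simp only [Matrix.map_mul] at h
  have e := charpoly_eq_of_mul_eq hunit h
  rw [Matrix.charpoly_map, Matrix.charpoly_map, Matrix.charpoly_map] at e
  exact Polynomial.map_injective ι hι e

/-- The image of `F` already supplies all the roots that `X^q - X` can have. -/
theorem mem_range_algebraMap_of_pow_card {F K : Type*} [Field F] [Fintype F] [Field K]
    [Algebra F K] {a : K} (ha : a ^ Fintype.card F = a) : a ∈ (algebraMap F K).range := by
  classical
  have hne : (X ^ Fintype.card F - X : K[X]) ≠ 0 :=
    FiniteField.X_pow_card_sub_X_ne_zero K Fintype.one_lt_card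
  have hsub : (Finset.univ.image (algebraMap F K)) ⊆
      (X ^ Fintype.card F - X : K[X]).roots.toFinset := by
    intro x hx
    obtain ⟨y, -, rfl⟩ := Finset.mem_image.1 hx
    rw [Multiset.mem_toFinset, mem_roots hne, IsRoot.def, eval_sub, eval_pow, eval_X, ← map_pow,
      FiniteField.pow_card, sub_self]
  have heq := Finset.eq_of_subset_of_card_le hsub (by
    rw [Finset.card_image_of_injective _ (algebraMap F K).injective, Finset.card_univ]
    refine (Multiset.toFinset_card_le _).trans ((card_roots' _).trans ?_)
    rw [FiniteField.X_pow_card_sub_X_natDegree_eq K Fintype.one_lt_card])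
  have : a ∈ Finset.univ.image (algebraMap F K) := by
    rw [heq, Multiset.mem_toFinset, mem_roots hne, IsRoot.def, eval_sub, eval_pow, eval_X, ha,
      sub_self]
  obtain ⟨y, -, hy⟩ := Finset.mem_image.1 this
  exact ⟨y, hy⟩

theorem exists_charpoly_coordMatrix {u : TwistedPolynomial Fq k} (hu : Commute Φ u) :
    ∃ P : Fq[X][X], P.map (mapRingHom (algebraMap Fq (Coeff Fq k))) =
      (coordMatrix hr hΦ u).charpoly := by
  rw [← mem_lifts, lifts_iff_coeff_lifts]
  intro n
  have h := congrArg (fun p => p.coeff n) (frobCoeff_charpoly hr hΦ hu)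
  simp only [Polynomial.coeff_map] at h
  have h2 : (coordMatrix hr hΦ u).charpoly.coeff n ∈ lifts (algebraMap Fq (Coeff Fq k)) := by
    rw [lifts_iff_coeff_lifts]
    intro m
    have h3 := congrArg (fun p => p.coeff m) h
    simp only [frobCoeff, coe_mapRingHom, Polynomial.coeff_map] at h3
    exact mem_range_algebraMap_of_pow_card h3
  exact (mem_lifts _).1 h2

end CoordMatrix

/-! ### Bases of Tate modules from bases of `M[l]` -/

section Tate

variable {R : Type*} [CommRing R] {l : R} {M : Type*} [AddCommGroup M] [Module R M]

theorem exists_tateModule_one (hsurj : ∀ y : M, ∃ x, l • x = y) {y : M} (hy : l • y = 0) :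
    ∃ x : TateModule l M, x.1 1 = y := by
  choose g hg using hsurj
  let f : ℕ → M := fun n => n.casesOn 0 fun m => g^[m] y
  have hf : ∀ n, l • f (n + 1) = f n := by
    intro n
    cases n with
    | zero => exact hy
    | succ n =>
      change l • g^[n + 1] y = g^[n] y
      rw [Function.iterate_succ_apply', hg]
  have ht : ∀ n, l ^ n • f n = 0 := by
    intro n
    induction n with
    | zero => exact smul_zero _
    | succ n ih => rw [pow_succ, mul_smul, hf, ih]
  exact ⟨⟨f, fun n => ⟨(Submodule.mem_torsionBy_iff _ _).2 (ht n), hf n⟩⟩, rfl⟩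

theorem pow_smul_coord_add (x : TateModule l M) (m n : ℕ) : l ^ n • x.1 (m + n) = x.1 m := by
  induction n with
  | zero => simp
  | succ n ih => rw [pow_succ, mul_smul, ← add_assoc, (x.2 (m + n)).2, ih]

variable {ι : Type*} [Fintype ι] {e : ι → TateModule l M}

/-- Since `l^n` maps the coordinate of index `n + 1` to that of index `1`, a combination matching
`l^n y` reduces `y` to an `l^n`-torsion point. -/
theorem exists_sum_smul_coord
    (hspan : ∀ y : M, l • y = 0 → ∃ a : ι → R, ∑ j, a j • (e j).1 1 = y)
    (n : ℕ) {y : M} (hy : l ^ n • y = 0) : ∃ a : ι → R, ∑ j, a j • (e j).1 n = y := by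
  induction n generalizing y with
  | zero => exact ⟨0, by simpa using hy.symm⟩
  | succ n ih =>
    obtain ⟨a, ha⟩ := hspan (l ^ n • y) (by rw [← mul_smul, ← pow_succ', hy])
    obtain ⟨b, hb⟩ := ih (y := y - ∑ j, a j • (e j).1 (n + 1)) (by
      rw [smul_sub, ← ha, Finset.smul_sum, sub_eq_zero]
      refine Finset.sum_congr rfl fun j _ => ?_
      rw [smul_comm, add_comm n 1, pow_smul_coord_add])
    refine ⟨fun j => a j + l * b j, ?_⟩
    simp only [add_smul, Finset.sum_add_distrib]
    rw [← eq_sub_iff_add_eq', ← hb]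
    refine Finset.sum_congr rfl fun j _ => ?_
    rw [mul_comm, mul_smul, ((e j).2 n).2]

theorem dvd_of_sum_smul_coord
    (hindep : ∀ a : ι → R, ∑ j, a j • (e j).1 1 = 0 → ∀ j, l ∣ a j)
    (n : ℕ) {a : ι → R} (h : ∑ j, a j • (e j).1 n = 0) (j : ι) : l ^ n ∣ a j := by
  induction n generalizing a j with
  | zero => simp
  | succ n ih =>
    have h1 : ∀ j, l ^ n ∣ a j := by
      refine ih ?_
      have := congrArg (l • ·) h
      simp only [Finset.smul_sum, smul_zero] at this
      rw [← this]
      refine Finset.sum_congr rfl fun j _ => ?_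
      rw [smul_comm, ((e j).2 n).2]
    choose b hb using h1
    rw [hb j, pow_succ]
    refine mul_dvd_mul_left _ (hindep b ?_ j)
    rw [← h]
    refine Finset.sum_congr rfl fun j _ => ?_
    rw [hb j, mul_comm, mul_smul, add_comm n 1, pow_smul_coord_add]

theorem sum_coord {κ : Type*} {s : Finset κ} (x : κ → TateModule l M) (n : ℕ) :
    (∑ j ∈ s, x j).1 n = ∑ j ∈ s, (x j).1 n := by
  rw [AddSubmonoidClass.coe_finsetSum, Finset.sum_apply]

theorem quotient_mk_eq_zero_iff (n : ℕ) (r : R) :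
    (Submodule.Quotient.mk r : R ⧸ (Ideal.span {l} ^ n • ⊤ : Submodule R R)) = 0 ↔ l ^ n ∣ r := by
  rw [Submodule.Quotient.mk_eq_zero, smul_eq_mul, Ideal.mul_top, Ideal.span_singleton_pow,
    Ideal.mem_span_singleton]

/-- Elements of the Tate module whose first coordinates form a basis of `M[l]` over `R / l` form
a basis of the Tate module. -/
def tateBasis
    (hspan : ∀ y : M, l • y = 0 → ∃ a : ι → R, ∑ j, a j • (e j).1 1 = y)
    (hindep : ∀ a : ι → R, ∑ j, a j • (e j).1 1 = 0 → ∀ j, l ∣ a j) :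
    Module.Basis ι (Completion l) (TateModule l M) :=
  Module.Basis.mk (v := e)
    (by
      rw [Fintype.linearIndependent_iff]
      intro a ha j
      refine AdicCompletion.ext fun n => ?_
      choose r hr using fun j => exists_rep (a j) n
      have h := congrArg (fun x => x.1 n) ha
      simp only [sum_coord, smul_coord _ _ n _ (hr _ n le_rfl)] at h
      rw [hr j n le_rfl]
      exact (quotient_mk_eq_zero_iff n _).2 (dvd_of_sum_smul_coord hindep n h j))
    (by
      rintro x -
      choose a ha using fun n => exists_sum_smul_coord hspan n (pow_smul_coord x n)
      -- The coefficients are chosen separately at each level; independence modulo `l^n` makes them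
      -- Cauchy.
      have hc : ∀ j n, a n j ≡ a (n + 1) j [SMOD (Ideal.span {l} ^ n • ⊤ : Submodule R R)] := by
        intro j n
        rw [SModEq.def, ← sub_eq_zero, ← Submodule.Quotient.mk_sub, quotient_mk_eq_zero_iff]
        refine dvd_of_sum_smul_coord hindep n (a := fun j => a n j - a (n + 1) j) ?_ j
        simp only [sub_smul, Finset.sum_sub_distrib]
        rw [ha n, sub_eq_zero, ← (x.2 n).2, ← ha (n + 1), Finset.smul_sum]
        refine Finset.sum_congr rfl fun j _ => ?_
        rw [smul_comm, ((e j).2 n).2]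
      let A : ι → Completion l := fun j =>
        AdicCompletion.mk _ _ (AdicCompletion.AdicCauchySequence.mk _ _ (fun n => a n j) (hc j))
      have hx : x = ∑ j, A j • e j := by
        ext n
        rw [sum_coord, ← ha n]
        exact Finset.sum_congr rfl fun j _ => (smul_coord _ _ n _ rfl).symm
      rw [hx]
      exact Submodule.sum_mem _ fun j _ =>
        Submodule.smul_mem _ _ (Submodule.subset_span ⟨j, rfl⟩))

theorem tateBasis_apply
    (hspan : ∀ y : M, l • y = 0 → ∃ a : ι → R, ∑ j, a j • (e j).1 1 = y)
    (hindep : ∀ a : ι → R, ∑ j, a j • (e j).1 1 = 0 → ∀ j, l ∣ a j) (j : ι) :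
    tateBasis hspan hindep j = e j :=
  Module.Basis.mk_apply _ _ j

/-- Counting: a vector space with `Q^r` elements over the field `R / l` of `Q` elements has
dimension `r`. Divisibility lifts its basis to the Tate module. -/
theorem exists_tateModule_generators (hsurj : ∀ y : M, ∃ x, l • x = y)
    [hl : (Ideal.span {l}).IsMaximal] [Finite (Submodule.torsionBy R M l)] {r : ℕ} {Q : ℕ}
    (hQ : 1 < Q) (hR : Nat.card (R ⧸ Ideal.span {l}) = Q)
    (hV : Nat.card (Submodule.torsionBy R M l) = Q ^ r) :
    ∃ e : Fin r → TateModule l M,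
      (∀ y : M, l • y = 0 → ∃ a : Fin r → R, ∑ j, a j • (e j).1 1 = y) ∧
      ∀ a : Fin r → R, ∑ j, a j • (e j).1 1 = 0 → ∀ j, l ∣ a j := by
  let _ : Field (R ⧸ Ideal.span {l}) := Ideal.Quotient.field _
  have hfr : Module.finrank (R ⧸ Ideal.span {l}) (Submodule.torsionBy R M l) = r := by
    have := Module.natCard_eq_pow_finrank (K := R ⧸ Ideal.span {l})
      (V := Submodule.torsionBy R M l)
    rw [hR, hV] at this
    exact (Nat.pow_right_injective hQ this).symm
  have b := Module.finBasisOfFinrankEq (R ⧸ Ideal.span {l}) (Submodule.torsionBy R M l) hfr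
  choose e he using fun j =>
    exists_tateModule_one hsurj ((Submodule.mem_torsionBy_iff _ _).1 (b j).2)
  have hsum : ∀ a : Fin r → R, ∑ j, a j • (e j).1 1 =
      (∑ j, (Ideal.Quotient.mk (Ideal.span {l}) (a j)) • b j : Submodule.torsionBy R M l) := by
    intro a
    rw [AddSubmonoidClass.coe_finsetSum]
    exact Finset.sum_congr rfl fun j _ => by rw [he]; rfl
  refine ⟨e, fun y hy => ?_, fun a ha j => ?_⟩
  · choose a ha using fun j => Ideal.Quotient.mk_surjective
      (b.repr ⟨y, (Submodule.mem_torsionBy_iff _ _).2 hy⟩ j)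
    refine ⟨a, ?_⟩
    simp only [hsum, ha, b.sum_repr]
  · rw [hsum] at ha
    have := Fintype.linearIndependent_iff.1 b.linearIndependent _ (Subtype.ext ha) j
    rwa [Ideal.Quotient.eq_zero_iff_mem, Ideal.mem_span_singleton] at this

end Tate

/-! ### Degree zero coefficients -/

section ConstantCoeff

variable {Fq k : Type*} [Field Fq] [Fintype Fq] [Field k] [Algebra Fq k]

/-- Only the linear term survives, as `q = 0` in `k̄`. By the chain rule the degree zero coefficient
is therefore multiplicative. -/
theorem derivative_linPoly (w : TwistedPolynomial Fq k) :
    derivative (linPoly w) = C (coeffEmb Fq k (SkewPolynomial.coeff w 0)) := by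
  have hq : ((Fintype.card Fq : ℕ) : AlgebraicClosure k) = 0 := by
    have := congrArg (algebraMap Fq (AlgebraicClosure k)) (FiniteField.cast_card_eq_zero Fq)
    rwa [map_natCast, map_zero] at this
  rw [linPoly, derivative_sum]
  simp only [derivative_monomial]
  rw [Finset.sum_eq_single 0]
  · simp
  · intro n _ hn
    rw [Nat.cast_pow, hq, zero_pow hn, mul_zero, monomial_zero_right]
  · intro h
    rw [SkewPolynomial.notMem_support_iff] at h
    rw [h, map_zero, zero_mul, monomial_zero_right]

theorem coeff_mul_zero (v w : TwistedPolynomial Fq k) :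
    SkewPolynomial.coeff (v * w) 0 = SkewPolynomial.coeff v 0 * SkewPolynomial.coeff w 0 := by
  have h := derivative_linPoly (v * w)
  rw [linPoly_mul, derivative_comp, derivative_linPoly, derivative_linPoly, C_comp, ← C_mul,
    ← map_mul] at h
  rw [mul_comm]
  exact (coeffEmb_injective (C_injective h)).symm

theorem coeff_pow_zero (w : TwistedPolynomial Fq k) (n : ℕ) :
    SkewPolynomial.coeff (w ^ n) 0 = SkewPolynomial.coeff w 0 ^ n := by
  induction n with
  | zero => simp
  | succ n ih => rw [pow_succ, coeff_mul_zero, ih, pow_succ]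

theorem algebraMap_twisted (c : Fq) :
    algebraMap Fq (TwistedPolynomial Fq k) c =
      SkewPolynomial.C (algebraMap Fq (Coeff Fq k) c) := rfl

end ConstantCoeff

end Drinfeld

/-! ### Rank and torsion points of a Drinfeld module -/

namespace DrinfeldModule

open Drinfeld

variable {Fq k : Type*} [Field Fq] [Fintype Fq] [Field k] [Algebra Fq k]
variable (φ : DrinfeldModule Fq k)

theorem toAlgHom_monomial (n : ℕ) (c : Fq) : φ.toAlgHom (monomial n c) =
    SkewPolynomial.C (algebraMap Fq (Coeff Fq k) c) * φ.toAlgHom X ^ n := by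
  rw [← C_mul_X_pow_eq_monomial, map_mul, map_pow, ← algebraMap_eq, AlgHom.commutes,
    algebraMap_twisted]

theorem mul_toAlgHom_eq_act (a : Fq[X]) (w : TwistedPolynomial Fq k) :
    w * φ.toAlgHom a = act (φ.toAlgHom X) (a.map (algebraMap Fq (Coeff Fq k))) w := by
  induction a using Polynomial.induction_on' with
  | add p q hp hq => rw [map_add, mul_add, Polynomial.map_add, act_add, hp, hq]
  | monomial n c =>
    rw [Polynomial.map_monomial, act_monomial, toAlgHom_monomial, twisted_smul_eq,
      ← algebraMap_twisted, ← mul_assoc, ← mul_assoc, Algebra.commutes]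

theorem coeff_toAlgHom_zero (a : Fq[X]) : SkewPolynomial.coeff (φ.toAlgHom a) 0 =
    aeval (SkewPolynomial.coeff (φ.toAlgHom X) 0) a := by
  induction a using Polynomial.induction_on' with
  | add p q hp hq => rw [map_add, SkewPolynomial.coeff_add, map_add, hp, hq]
  | monomial n c =>
    rw [toAlgHom_monomial, coeff_mul_zero, coeff_pow_zero, SkewPolynomial.coeff_C_zero,
      aeval_monomial]

theorem aeval_ne_zero_of_ne_characteristic {l : Fq[X]} (hm : l.Monic) (hirr : Irreducible l)
    (hne : l ≠ φ.characteristic) :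
    aeval (SkewPolynomial.coeff (φ.toAlgHom X) 0) l ≠ 0 :=
  fun h => hne (minpoly.eq_of_irreducible_of_monic hirr h hm)

/-- The rank is positive: if `φ_T` were a constant of the finite field `k`, then `X^#k - X` would
lie in the kernel of `φ`. -/
theorem exists_tauDegree [FiniteDimensional Fq k] :
    ∃ r : ℕ, 0 < r ∧ tauDegree (φ.toAlgHom X) = r ∧ φ.rank = r := by
  have : Finite k := Module.finite_of_finite Fq
  have : Fintype k := Fintype.ofFinite k
  rcases h : tauDegree (φ.toAlgHom X) with _ | r
  · exact absurd (φ.injective ((tauDegree_eq_bot.1 h).trans (map_zero _).symm)) X_ne_zero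
  refine ⟨r, Nat.pos_of_ne_zero ?_, rfl, by rw [rank, h]; rfl⟩
  rintro rfl
  have hC : φ.toAlgHom X = SkewPolynomial.C (SkewPolynomial.coeff (φ.toAlgHom X) 0) := by
    ext n
    rw [SkewPolynomial.coeff_C]
    split_ifs with hn
    · rw [hn]
    · by_contra hc
      have := (Finset.le_max (SkewPolynomial.mem_support_iff.2 hc)).trans h.le
      exact hn (Nat.le_zero.1 (WithBot.coe_le_coe.1 this))
  have h0 : φ.toAlgHom (X ^ Fintype.card k - X) = 0 := by
    have hk : ∀ c : Coeff Fq k, c ^ Fintype.card k = c := FiniteField.pow_card (K := k)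
    rw [map_sub, map_pow, hC, ← SkewPolynomial.C_pow, hk, sub_self]
  exact FiniteField.X_pow_card_sub_X_ne_zero Fq Fintype.one_lt_card
    (φ.injective (h0.trans (map_zero _).symm))

variable {φ}

theorem degree_linPoly_toAlgHom {r : ℕ} (hr : 0 < r) (hΦ : tauDegree (φ.toAlgHom X) = r)
    {L : Fq[X]} (hL : L ≠ 0) :
    (linPoly (φ.toAlgHom L)).degree = (Fintype.card Fq ^ (r * L.natDegree) : ℕ) := by
  have h1 : tauDegree (1 : TwistedPolynomial Fq k) = (0 : ℕ) := tauDegree_C one_ne_zero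
  have hL' : L.map (algebraMap Fq (Coeff Fq k)) ≠ 0 :=
    (Polynomial.map_ne_zero_iff (algebraMap Fq (Coeff Fq k)).injective).2 hL
  rw [degree_linPoly, ← one_mul (φ.toAlgHom L), mul_toAlgHom_eq_act, tauDegree_act hr hΦ hL' h1,
    zero_add, natDegree_map]
  rfl

theorem smul_surjective {r : ℕ} (hr : 0 < r) (hΦ : tauDegree (φ.toAlgHom X) = r)
    {l : Fq[X]} (hl : l ≠ 0) (y : φ.Points) : ∃ x : φ.Points, l • x = y := by
  have hd := degree_linPoly_toAlgHom hr hΦ hl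
  have hpos : (0 : WithBot ℕ) < (linPoly (φ.toAlgHom l)).degree := by
    rw [hd]
    exact WithBot.coe_lt_coe.2 (pow_pos (zero_lt_one.trans (one_lt_card_Fq Fq)) _)
  let y' : AlgebraicClosure k := y
  obtain ⟨x, hx⟩ := IsAlgClosed.exists_root (linPoly (φ.toAlgHom l) - C y')
    (by rw [degree_sub_C hpos]; exact hpos.ne')
  refine ⟨x, ?_⟩
  rw [IsRoot.def, eval_sub, eval_C, sub_eq_zero, eval_linPoly] at hx
  exact hx

/-- The derivative of the `q`-polynomial of `φ_L` is a nonzero constant, so its roots are simple and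
their number is its degree. Here `L` may be a prime power. -/
theorem card_torsionBy {r : ℕ} (hr : 0 < r) (hΦ : tauDegree (φ.toAlgHom X) = r)
    {L : Fq[X]} (hL : aeval (SkewPolynomial.coeff (φ.toAlgHom X) 0) L ≠ 0) :
    Nat.card (Submodule.torsionBy Fq[X] φ.Points L) = Fintype.card Fq ^ (r * L.natDegree) := by
  have hL0 : L ≠ 0 := by
    rintro rfl
    exact hL (map_zero _)
  have hd := degree_linPoly_toAlgHom hr hΦ hL0
  have hsep : (linPoly (φ.toAlgHom L)).Separable := by
    rw [separable_def, derivative_linPoly, coeff_toAlgHom_zero]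
    have hc := (map_ne_zero_iff _ coeffEmb_injective).2 hL
    exact ⟨0, C (coeffEmb Fq k (aeval (SkewPolynomial.coeff (φ.toAlgHom X) 0) L))⁻¹, by
      rw [zero_mul, zero_add, ← C_mul, inv_mul_cancel₀ hc, C_1]⟩
  have h0 : linPoly (φ.toAlgHom L) ≠ 0 := hsep.ne_zero
  have hcard := card_rootSet_eq_natDegree (K := AlgebraicClosure k) hsep
    (IsAlgClosed.splits _)
  rw [natDegree_eq_of_degree_eq_some hd] at hcard
  rw [← hcard, ← Nat.card_eq_fintype_card]
  refine Nat.card_congr (Equiv.subtypeEquivRight fun x => ?_)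
  have key : ∀ z : AlgebraicClosure k,
      aeval z (linPoly (φ.toAlgHom L)) = 0 ↔ evalHom Fq k (φ.toAlgHom L) z = 0 := fun z => by
    rw [coe_aeval_eq_eval, eval_linPoly]
  exact (Submodule.mem_torsionBy_iff _ _).trans
    ((key x).symm.trans (mem_rootSet_of_ne h0).symm)

theorem exists_tate_generators {r : ℕ} (hr : 0 < r) (hΦ : tauDegree (φ.toAlgHom X) = r)
    {l : Fq[X]} (hm : l.Monic) (hirr : Irreducible l)
    (hne : l ≠ φ.characteristic) :
    ∃ e : Fin r → TateModule l φ.Points,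
      (∀ y : φ.Points, l • y = 0 → ∃ a : Fin r → Fq[X], ∑ j, a j • (e j).1 1 = y) ∧
      ∀ a : Fin r → Fq[X], ∑ j, a j • (e j).1 1 = 0 → ∀ j, l ∣ a j := by
  have hV := card_torsionBy hr hΦ (aeval_ne_zero_of_ne_characteristic φ hm hirr hne)
  have hq := zero_lt_one.trans (one_lt_card_Fq Fq)
  have : Finite (Submodule.torsionBy Fq[X] φ.Points l) :=
    Nat.finite_of_card_ne_zero (by rw [hV]; exact (pow_pos hq _).ne')
  have : (Ideal.span {l}).IsMaximal := PrincipalIdealRing.isMaximal_of_irreducible hirr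
  have : Module.Finite Fq (Fq[X] ⧸ Ideal.span {l}) := hm.finite_quotient
  have hR : Nat.card (Fq[X] ⧸ Ideal.span {l}) = Fintype.card Fq ^ l.natDegree := by
    rw [Module.natCard_eq_pow_finrank (K := Fq), finrank_quotient_span_eq_natDegree,
      Nat.card_eq_fintype_card]
  refine exists_tateModule_generators (smul_surjective hr hΦ hm.ne_zero)
    (Q := Fintype.card Fq ^ l.natDegree)
    (Nat.one_lt_pow hirr.natDegree_pos.ne' (one_lt_card_Fq Fq)) hR ?_
  rw [hV, ← pow_mul, mul_comm]

end DrinfeldModule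

/-! ### The pairing between `k{τ}` and the `L`-torsion -/

theorem Polynomial.coeff_divX_iterate {R : Type*} [Semiring R] (p : R[X]) (m n : ℕ) :
    (divX^[m] p).coeff n = p.coeff (n + m) := by
  induction m generalizing n with
  | zero => rfl
  | succ m ih => rw [Function.iterate_succ_apply', coeff_divX, ih, add_assoc, add_comm 1 m]

theorem Polynomial.X_mul_divX_iterate_add {R : Type*} [CommSemiring R] (p : R[X]) (m : ℕ) :
    X * divX^[m + 1] p + C (p.coeff m) = divX^[m] p := by
  have h := X_mul_divX_add (divX^[m] p)
  rwa [coeff_divX_iterate, zero_add, ← Function.iterate_succ_apply' divX] at h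

theorem Polynomial.divX_iterate_natDegree {R : Type*} [Semiring R] (p : R[X]) :
    divX^[p.natDegree] p = C p.leadingCoeff := by
  ext n
  rw [coeff_divX_iterate, coeff_C]
  split_ifs with hn
  · rw [hn, zero_add, leadingCoeff]
  · exact coeff_eq_zero_of_natDegree_lt (by omega)

namespace DrinfeldModule

open Drinfeld

variable {Fq k : Type*} [Field Fq] [Fintype Fq] [Field k] [Algebra Fq k]
variable (φ : DrinfeldModule Fq k)

/-- The value at a point of the additive polynomial attached to a twisted polynomial. -/
def ptEval (w : TwistedPolynomial Fq k) : φ.Points →+ AlgebraicClosure k :=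
  (evalHom Fq k w).toAddMonoidHom

theorem ptEval_eq_eval (w : TwistedPolynomial Fq k) (x : φ.Points) :
    φ.ptEval w x = (linPoly w).eval (id x : AlgebraicClosure k) := (eval_linPoly w _).symm

theorem ptEval_add (v w : TwistedPolynomial Fq k) (x : φ.Points) :
    φ.ptEval (v + w) x = φ.ptEval v x + φ.ptEval w x :=
  LinearMap.congr_fun (map_add (evalHom Fq k) v w) _

theorem ptEval_mul_toAlgHom (w : TwistedPolynomial Fq k) (a : Fq[X]) (x : φ.Points) :
    φ.ptEval (w * φ.toAlgHom a) x = φ.ptEval w (a • x) :=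
  LinearMap.congr_fun (map_mul (evalHom Fq k) w (φ.toAlgHom a)) _

theorem ptEval_mul_end (w : TwistedPolynomial Fq k) (u : φ.End) (x : φ.Points) :
    φ.ptEval (w * u.1) x = φ.ptEval w (φ.endPoints u x) :=
  LinearMap.congr_fun (map_mul (evalHom Fq k) w u.1) _

theorem evalHom_C (a : Coeff Fq k) (z : AlgebraicClosure k) :
    evalHom Fq k (SkewPolynomial.C a) z = coeffEmb Fq k a * z := by
  rw [← SkewPolynomial.monomial_zero_left, evalHom_monomial, pow_zero, pow_one]
  rfl

theorem ptEval_smul (a : Coeff Fq k) (w : TwistedPolynomial Fq k) (x : φ.Points) :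
    φ.ptEval (a • w) x = coeffEmb Fq k a * φ.ptEval w x := by
  rw [twisted_smul_eq]
  exact (LinearMap.congr_fun (map_mul (evalHom Fq k) (SkewPolynomial.C a) w) _).trans
    (evalHom_C a _)

theorem coeffEmb_algebraMap (c : Fq) :
    coeffEmb Fq k (algebraMap Fq (Coeff Fq k) c) = algebraMap Fq (AlgebraicClosure k) c :=
  (IsScalarTower.algebraMap_apply Fq k (AlgebraicClosure k) c).symm

theorem ptEval_C_smul (w : TwistedPolynomial Fq k) (c : Fq) (x : φ.Points) :
    φ.ptEval w ((C c : Fq[X]) • x) = algebraMap Fq (AlgebraicClosure k) c * φ.ptEval w x := by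
  rw [← ptEval_mul_toAlgHom, ← algebraMap_eq, AlgHom.commutes, ← Algebra.commutes,
    algebraMap_twisted, ← twisted_smul_eq, ptEval_smul, coeffEmb_algebraMap]

/-- The polynomial `∑ⱼ cⱼ ∑_{s < j} w(Tˢ x) T ^ (j - 1 - s)` for `L = ∑ⱼ cⱼ Tʲ`. -/
def pairing (L : Fq[X]) (w : TwistedPolynomial Fq k) (x : φ.Points) : (AlgebraicClosure k)[X] :=
  ∑ m ∈ Finset.range L.natDegree, monomial m (φ.ptEval w (divX^[m + 1] L • x))

variable (L : Fq[X])

theorem coeff_pairing (w : TwistedPolynomial Fq k) (x : φ.Points) (n : ℕ) :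
    (φ.pairing L w x).coeff n =
      if n < L.natDegree then φ.ptEval w (divX^[n + 1] L • x) else 0 := by
  rw [pairing, finsetSum_coeff]
  simp only [coeff_monomial, Finset.sum_ite_eq', Finset.mem_range]

theorem degree_pairing_lt (w : TwistedPolynomial Fq k) (x : φ.Points) :
    (φ.pairing L w x).degree < L.natDegree := by
  rw [degree_lt_iff_coeff_zero]
  intro n hn
  rw [coeff_pairing, if_neg (not_lt.2 hn)]

theorem pairing_add_left (v w : TwistedPolynomial Fq k) (x : φ.Points) :
    φ.pairing L (v + w) x = φ.pairing L v x + φ.pairing L w x := by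
  simp only [pairing, ptEval_add, map_add, Finset.sum_add_distrib]

theorem pairing_add_right (w : TwistedPolynomial Fq k) (x y : φ.Points) :
    φ.pairing L w (x + y) = φ.pairing L w x + φ.pairing L w y := by
  simp only [pairing, smul_add, map_add, Finset.sum_add_distrib]

theorem pairing_smul_left (a : Coeff Fq k) (w : TwistedPolynomial Fq k) (x : φ.Points) :
    φ.pairing L (a • w) x = C (coeffEmb Fq k a) * φ.pairing L w x := by
  simp only [pairing, ptEval_smul, Finset.mul_sum, C_mul_monomial]

theorem pairing_C_smul_right (w : TwistedPolynomial Fq k) (c : Fq) (x : φ.Points) :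
    φ.pairing L w ((C c : Fq[X]) • x) =
      C (algebraMap Fq (AlgebraicClosure k) c) * φ.pairing L w x := by
  simp only [pairing, smul_comm _ (C c : Fq[X]), ptEval_C_smul, Finset.mul_sum, C_mul_monomial]

theorem pairing_mul_toAlgHom (w : TwistedPolynomial Fq k) (a : Fq[X]) (x : φ.Points) :
    φ.pairing L (w * φ.toAlgHom a) x = φ.pairing L w (a • x) := by
  simp only [pairing, ptEval_mul_toAlgHom, smul_comm a]

theorem pairing_mul_end (w : TwistedPolynomial Fq k) (u : φ.End) (x : φ.Points) :
    φ.pairing L (w * u.1) x = φ.pairing L w (φ.endPoints u x) := by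
  simp only [pairing, ptEval_mul_end, map_smul]

/-- The pairing is `w` applied to `(L(T) - L(φ_T)) / (T - φ_T)` at `x`, with `T` a free variable;
this is the identity obtained by clearing the denominator. Modulo `L` and on `L`-torsion, both extra
terms vanish and `T` can be moved onto the point. -/
theorem X_mul_pairing_add (w : TwistedPolynomial Fq k) (x : φ.Points) :
    X * φ.pairing L w x + C (φ.ptEval w (L • x)) =
      φ.pairing L w ((X : Fq[X]) • x) +
        C (φ.ptEval w x) * L.map (algebraMap Fq (AlgebraicClosure k)) := by
  let f : ℕ → AlgebraicClosure k := fun m => φ.ptEval w (divX^[m] L • x)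
  let g : ℕ → AlgebraicClosure k := fun m => φ.ptEval w (divX^[m + 1] L • (X : Fq[X]) • x)
  have hfg : ∀ m, f m = g m + φ.ptEval w x * algebraMap Fq (AlgebraicClosure k) (L.coeff m) := by
    intro m
    change φ.ptEval w (divX^[m] L • x) = _
    rw [← X_mul_divX_iterate_add, add_smul, map_add, ptEval_C_smul, mul_comm X, mul_smul,
      mul_comm (algebraMap _ _ _)]
  have hd : f L.natDegree =
      φ.ptEval w x * algebraMap Fq (AlgebraicClosure k) (L.coeff L.natDegree) := by
    change φ.ptEval w (divX^[L.natDegree] L • x) = _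
    rw [divX_iterate_natDegree, ptEval_C_smul, mul_comm, leadingCoeff]
  have h1 : X * φ.pairing L w x + C (φ.ptEval w (L • x)) =
      ∑ m ∈ Finset.range (L.natDegree + 1), monomial m (f m) := by
    rw [Finset.sum_range_succ', pairing, Finset.mul_sum]
    simp only [X_mul_monomial]
    rfl
  have h2 : C (φ.ptEval w x) * L.map (algebraMap Fq (AlgebraicClosure k)) =
      ∑ m ∈ Finset.range (L.natDegree + 1),
        monomial m (φ.ptEval w x * algebraMap Fq (AlgebraicClosure k) (L.coeff m)) := by
    conv_lhs => rw [L.as_sum_range, Polynomial.map_sum, Finset.mul_sum]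
    simp only [Polynomial.map_monomial, C_mul_monomial]
  rw [h1, h2, Finset.sum_range_succ, Finset.sum_range_succ, hd, ← add_assoc]
  congr 1
  change _ = (∑ m ∈ Finset.range L.natDegree, monomial m (g m)) + _
  rw [← Finset.sum_add_distrib]
  exact Finset.sum_congr rfl fun m _ => by rw [hfg m, map_add]

/-- `L`, as a polynomial over the algebraic closure of `k`. -/
abbrev baseChange (k : Type*) [Field k] [Algebra Fq k] (L : Fq[X]) : (AlgebraicClosure k)[X] :=
  L.map (algebraMap Fq (AlgebraicClosure k))

/-- The pairing between `k{τ}` and the `L`-torsion, with values in `k̄[T] / L`. -/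
def pairingMod (w : TwistedPolynomial Fq k) (x : φ.Points) : AdjoinRoot (baseChange k L) :=
  AdjoinRoot.mk _ (φ.pairing L w x)

/-- Reduction of polynomials over `k` modulo `L`. -/
def reduceCoeff : (Coeff Fq k)[X] →+* AdjoinRoot (baseChange k L) :=
  (AdjoinRoot.mk _).comp (mapRingHom (coeffEmb Fq k))

variable (k) in
/-- Reduction of polynomials over `Fq` modulo `L`. -/
def reduceBase : Fq[X] →+* AdjoinRoot (baseChange k L) :=
  (AdjoinRoot.mk _).comp (mapRingHom (algebraMap Fq (AlgebraicClosure k)))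

theorem reduceCoeff_comp_map :
    (reduceCoeff L).comp (mapRingHom (algebraMap Fq (Coeff Fq k))) = reduceBase k L := by
  rw [reduceCoeff, RingHom.comp_assoc, mapRingHom_comp]
  congr 2

theorem pairingMod_add_left (v w : TwistedPolynomial Fq k) (x : φ.Points) :
    φ.pairingMod L (v + w) x = φ.pairingMod L v x + φ.pairingMod L w x := by
  rw [pairingMod, pairing_add_left, map_add]; rfl

theorem pairingMod_add_right (w : TwistedPolynomial Fq k) (x y : φ.Points) :
    φ.pairingMod L w (x + y) = φ.pairingMod L w x + φ.pairingMod L w y := by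
  rw [pairingMod, pairing_add_right, map_add]; rfl

theorem pairingMod_smul_right (w : TwistedPolynomial Fq k) (a : Fq[X]) {x : φ.Points}
    (hx : L • x = 0) : φ.pairingMod L w (a • x) = reduceBase k L a * φ.pairingMod L w x := by
  have hX : ∀ y : φ.Points, L • y = 0 →
      φ.pairingMod L w ((X : Fq[X]) • y) = reduceBase k L X * φ.pairingMod L w y := by
    intro y hy
    have h := congrArg (AdjoinRoot.mk (baseChange k L)) (φ.X_mul_pairing_add L w y)
    rw [hy, map_zero, C_0, add_zero, map_add, map_mul (AdjoinRoot.mk _) (C _) (L.map _),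
      AdjoinRoot.mk_self, mul_zero, add_zero, map_mul] at h
    rw [pairingMod, ← h, reduceBase, RingHom.comp_apply, coe_mapRingHom, Polynomial.map_X]
    rfl
  have hC : ∀ (c : Fq) (y : φ.Points),
      φ.pairingMod L w ((C c : Fq[X]) • y) = reduceBase k L (C c) * φ.pairingMod L w y := by
    intro c y
    rw [pairingMod, pairing_C_smul_right, map_mul, reduceBase, RingHom.comp_apply,
      coe_mapRingHom, Polynomial.map_C]
    rfl
  induction a using Polynomial.induction_on generalizing x with
  | C c => exact hC c x
  | add p q hp hq => rw [add_smul, pairingMod_add_right, hp hx, hq hx, map_add, add_mul]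
  | monomial n c ih =>
    have hXx : L • (X : Fq[X]) • x = 0 := by rw [smul_comm, hx, smul_zero]
    rw [pow_succ, ← mul_assoc, mul_smul, ih hXx, hX x hx, map_mul (reduceBase k L) (C c * X ^ n),
      mul_assoc]

theorem pairingMod_act (w : TwistedPolynomial Fq k) (p : (Coeff Fq k)[X]) {x : φ.Points}
    (hx : L • x = 0) :
    φ.pairingMod L (act (φ.toAlgHom X) p w) x = reduceCoeff L p * φ.pairingMod L w x := by
  induction p using Polynomial.induction_on' with
  | add p q hp hq => rw [act_add, pairingMod_add_left, hp, hq, map_add, add_mul]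
  | monomial s a =>
    rw [act_monomial, pairingMod, pairing_smul_left, ← map_pow, pairing_mul_toAlgHom, map_mul]
    change _ * φ.pairingMod L w ((X ^ s : Fq[X]) • x) = _
    rw [pairingMod_smul_right φ L w _ hx, ← mul_assoc, reduceBase, reduceCoeff,
      RingHom.comp_apply, RingHom.comp_apply, coe_mapRingHom, coe_mapRingHom, Polynomial.map_pow,
      Polynomial.map_X, Polynomial.map_monomial, ← map_mul, C_mul_X_pow_eq_monomial]

/-- `pairingMod` as an additive map in the first variable. -/
def pairingModLeft (x : φ.Points) : TwistedPolynomial Fq k →+ AdjoinRoot (baseChange k L) :=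
  AddMonoidHom.mk' (fun w => φ.pairingMod L w x) fun v w => φ.pairingMod_add_left L v w x

/-- `pairingMod` as an additive map in the second variable. -/
def pairingModRight (w : TwistedPolynomial Fq k) : φ.Points →+ AdjoinRoot (baseChange k L) :=
  AddMonoidHom.mk' (φ.pairingMod L w) (φ.pairingMod_add_right L w)

theorem pairingMod_sum_smul {ι : Type*} (s : Finset ι) (w : TwistedPolynomial Fq k) (a : ι → Fq[X])
    {x : ι → φ.Points} (hx : ∀ j, L • x j = 0) :
    φ.pairingMod L w (∑ j ∈ s, a j • x j) =
      ∑ j ∈ s, reduceBase k L (a j) * φ.pairingMod L w (x j) := by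
  change φ.pairingModRight L w _ = _
  rw [map_sum]
  exact Finset.sum_congr rfl fun j _ => φ.pairingMod_smul_right L w (a j) (hx j)

theorem pairingMod_comb {r : ℕ} (p : Fin r → (Coeff Fq k)[X]) {x : φ.Points} (hx : L • x = 0) :
    φ.pairingMod L (comb (φ.toAlgHom X) p) x =
      ∑ j, reduceCoeff L (p j) * φ.pairingMod L (SkewPolynomial.X ^ (j : ℕ)) x := by
  change φ.pairingModLeft L x _ = _
  rw [comb, map_sum]
  exact Finset.sum_congr rfl fun j _ => φ.pairingMod_act L _ (p j) hx

/-- The Gram matrix of `pairingMod` between `1, τ, …, τʳ⁻¹` and the points `eⱼ`. -/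
def pairingMatrix {r : ℕ} (e : Fin r → φ.Points) :
    Matrix (Fin r) (Fin r) (AdjoinRoot (baseChange k L)) :=
  fun i j => φ.pairingMod L (SkewPolynomial.X ^ (i : ℕ)) (e j)

variable {φ L}

/-- Both entries are the pairing of `τ^i u` with `e j`: expand either `τ^i u` in the basis or `u(e
j)` in the points. -/
theorem coordMatrix_mul_pairingMatrix {r : ℕ} (hr : 0 < r) (hΦ : tauDegree (φ.toAlgHom X) = r)
    (u : φ.End) {e : Fin r → φ.Points} (he : ∀ j, L • e j = 0) {W : Matrix (Fin r) (Fin r) Fq[X]}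
    (hW : ∀ j, φ.endPoints u (e j) = ∑ i, W i j • e i) :
    (coordMatrix hr hΦ u.1).map (reduceCoeff L) * φ.pairingMatrix L e =
      φ.pairingMatrix L e * W.map (reduceBase k L) := by
  ext i j
  rw [Matrix.mul_apply, Matrix.mul_apply]
  simp only [Matrix.map_apply, pairingMatrix]
  rw [← φ.pairingMod_comb L (coordMatrix hr hΦ u.1 i) (he j), comb_coordMatrix]
  have h : φ.pairingMod L (SkewPolynomial.X ^ (i : ℕ) * u.1) (e j) =
      φ.pairingMod L (SkewPolynomial.X ^ (i : ℕ)) (φ.endPoints u (e j)) := by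
    rw [pairingMod, pairing_mul_end]; rfl
  rw [h, hW, φ.pairingMod_sum_smul L _ _ _ he]
  exact Finset.sum_congr rfl fun i' _ => mul_comm _ _

end DrinfeldModule

/-! ### Perfectness of the pairing -/

namespace DrinfeldModule

open Drinfeld

variable {Fq k : Type*} [Field Fq] [Fintype Fq] [Field k] [Algebra Fq k]
variable {φ : DrinfeldModule Fq k} {L : Fq[X]}

theorem degree_linPoly_X_pow_mul_toAlgHom {r : ℕ} (hΦ : tauDegree (φ.toAlgHom X) = r) (i s : ℕ) :
    (linPoly (SkewPolynomial.X ^ i * φ.toAlgHom (X ^ s))).degree =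
      (Fintype.card Fq ^ (i + r * s) : ℕ) := by
  rw [degree_linPoly, map_pow, tauDegree_mul, tauDegree_X_pow, tauDegree_pow _ hΦ]
  rfl

/-- Evaluations of the `q`-polynomials `τⁱ φ_T^s` with `i < r`, `s < deg L` are linearly
independent on the `L`-torsion. -/
theorem eq_zero_of_sum_ptEval_eq_zero {r : ℕ} (hr : 0 < r) (hΦ : tauDegree (φ.toAlgHom X) = r)
    (hL : aeval (SkewPolynomial.coeff (φ.toAlgHom X) 0) L ≠ 0)
    (c : Fin r → Fin L.natDegree → AlgebraicClosure k)
    (h : ∀ y : φ.Points, L • y = 0 →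
      ∑ i, ∑ s, c i s * φ.ptEval (SkewPolynomial.X ^ (i : ℕ)) ((X ^ (s : ℕ) : Fq[X]) • y) = 0) :
    c = 0 := by
  let f : Fin r × Fin L.natDegree → (AlgebraicClosure k)[X] := fun p =>
    C (c p.1 p.2) * linPoly (SkewPolynomial.X ^ (p.1 : ℕ) * φ.toAlgHom (X ^ (p.2 : ℕ)))
  have hf : ∀ p, c p.1 p.2 ≠ 0 →
      (f p).degree = (Fintype.card Fq ^ ((p.1 : ℕ) + r * p.2) : ℕ) := fun p hp => by
    rw [degree_C_mul hp, degree_linPoly_X_pow_mul_toAlgHom hΦ]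
  have hc : ∀ p, f p ≠ 0 → c p.1 p.2 ≠ 0 := fun p hp h0 => hp (by
    simp only [f]
    rw [h0, C_0, zero_mul])
  -- The degrees `q^(i + r s)` are distinct for distinct pairs `(i, s)` with `i < r`.
  have hdeg : (∑ p, f p).degree = Finset.univ.sup fun p => (f p).degree := by
    refine degree_sum_eq_of_disjoint f _ ?_
    rintro p ⟨-, hp⟩ p' ⟨-, hp'⟩ hne e
    simp only [Function.comp_apply, hf p (hc p hp), hf p' (hc p' hp')] at e
    have e1 : (p.1 : ℕ) + r * p.2 = p'.1 + r * p'.2 :=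
      card_pow_injective Fq (WithBot.coe_injective e)
    have e2 : p.1 = p'.1 := fin_eq_of_add_mul_eq e1
    rw [e2] at e1
    exact hne (Prod.ext e2 (Fin.ext (Nat.eq_of_mul_eq_mul_left hr (Nat.add_left_cancel e1))))
  have hlt : (∑ p, f p).degree < (Fintype.card Fq ^ (r * L.natDegree) : ℕ) := by
    rw [hdeg, Finset.sup_lt_iff (WithBot.bot_lt_coe _)]
    intro p _
    by_cases hp : c p.1 p.2 = 0
    · simp only [f]
      rw [hp, C_0, zero_mul, degree_zero]
      exact WithBot.bot_lt_coe _
    · rw [hf p hp]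
      refine WithBot.coe_lt_coe.2 (card_pow_strictMono Fq ?_)
      calc (p.1 : ℕ) + r * p.2 < r + r * p.2 := Nat.add_lt_add_right p.1.2 _
        _ = r * (p.2 + 1) := by ring
        _ ≤ r * L.natDegree := Nat.mul_le_mul_left _ p.2.2
  -- The combination vanishes at all `q^(r deg L)` torsion points, more than its degree allows.
  have hzero : ∑ p, f p = 0 := by
    have hV := card_torsionBy hr hΦ hL
    have hq : 0 < Fintype.card Fq ^ (r * L.natDegree) :=
      pow_pos (zero_lt_one.trans (one_lt_card_Fq Fq)) _
    have : Finite (Submodule.torsionBy Fq[X] φ.Points L) :=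
      Nat.finite_of_card_ne_zero (by rw [hV]; exact hq.ne')
    have : Fintype (Submodule.torsionBy Fq[X] φ.Points L) := Fintype.ofFinite _
    refine eq_zero_of_natDegree_lt_card_of_eval_eq_zero _
      (f := fun y : Submodule.torsionBy Fq[X] φ.Points L => (id y.1 : AlgebraicClosure k))
      Subtype.val_injective (fun y => ?_) ?_
    · rw [eval_finsetSum, Fintype.sum_prod_type, ← h y.1 ((Submodule.mem_torsionBy_iff _ _).1 y.2)]
      refine Finset.sum_congr rfl fun i _ => Finset.sum_congr rfl fun s _ => ?_
      rw [← ptEval_mul_toAlgHom, ptEval_eq_eval, eval_mul, eval_C]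
    · rw [← Nat.card_eq_fintype_card, hV]
      by_cases h0 : ∑ p, f p = 0
      · rw [h0, natDegree_zero]
        exact hq
      · exact (natDegree_lt_iff_degree_lt h0).2 hlt
  funext i s
  by_contra hne
  have h1 := Finset.le_sup (f := fun p => (f p).degree) (Finset.mem_univ (i, s))
  rw [← hdeg, hzero, degree_zero, hf (i, s) hne] at h1
  exact WithBot.coe_ne_bot (le_bot_iff.1 h1)

theorem mk_eq_sum_of_degree_lt {K : Type*} [Field K] (f p : K[X]) {d : ℕ} (hd : 0 < d)
    (hp : p.degree < d) :
    AdjoinRoot.mk f p =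
      ∑ s : Fin d, AdjoinRoot.mk f (C (p.coeff s)) * AdjoinRoot.mk f X ^ (s : ℕ) := by
  have hp' : p.natDegree < d := by
    by_cases h0 : p = 0
    · rwa [h0, natDegree_zero]
    · exact (natDegree_lt_iff_degree_lt h0).2 hp
  conv_lhs => rw [p.as_sum_range_C_mul_X_pow' hp']
  rw [map_sum, Finset.sum_range]
  simp only [map_mul, map_pow]

/-- Nondegeneracy on the left: the top coefficient of a vanishing pairing is a vanishing combination
of the values `τ^i(T^s y)`, and these are independent. -/
theorem eq_zero_of_vecMul_pairingMatrix {r : ℕ} (hr : 0 < r)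
    (hΦ : tauDegree (φ.toAlgHom X) = r) (hm : L.Monic) (hd : 0 < L.natDegree)
    (hL : aeval (SkewPolynomial.coeff (φ.toAlgHom X) 0) L ≠ 0)
    {e : Fin r → φ.Points} (he : ∀ j, L • e j = 0)
    (hspan : ∀ y : φ.Points, L • y = 0 → ∃ a : Fin r → Fq[X], ∑ j, a j • e j = y)
    (v : Fin r → AdjoinRoot (baseChange k L)) (hv : Matrix.vecMul v (φ.pairingMatrix L e) = 0) :
    v = 0 := by
  have hmon : (baseChange k L).Monic := hm.map _
  have hdeg : (baseChange k L).degree = L.natDegree := by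
    rw [degree_map, degree_eq_natDegree hm.ne_zero]
  have hrep : ∀ i, ∃ p : (AlgebraicClosure k)[X], p.degree < L.natDegree ∧
      AdjoinRoot.mk _ p = v i := by
    intro i
    obtain ⟨g, hg⟩ := AdjoinRoot.mk_surjective (v i)
    refine ⟨g %ₘ baseChange k L, (degree_modByMonic_lt g hmon).trans_eq hdeg, ?_⟩
    rw [← hg, AdjoinRoot.mk_eq_mk, modByMonic_eq_sub_mul_div, sub_sub_cancel_left, dvd_neg]
    exact dvd_mul_right _ _
  choose p hpd hp using hrep
  have hvy : ∀ y : φ.Points, L • y = 0 →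
      ∑ i, v i * φ.pairingMod L (SkewPolynomial.X ^ (i : ℕ)) y = 0 := by
    intro y hy
    obtain ⟨a, rfl⟩ := hspan y hy
    simp only [φ.pairingMod_sum_smul L _ _ _ he, Finset.mul_sum]
    rw [Finset.sum_comm]
    refine Finset.sum_eq_zero fun j _ => ?_
    have := congrFun hv j
    rw [Matrix.vecMul, dotProduct, Pi.zero_apply] at this
    rw [← mul_zero (reduceBase k L (a j)), ← this, Finset.mul_sum]
    exact Finset.sum_congr rfl fun i _ => mul_left_comm _ _ _
  have hc := eq_zero_of_sum_ptEval_eq_zero hr hΦ hL (fun i s => (p i).coeff s) (by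
    intro y hy
    -- Moving each `T^s` onto the point keeps the degree below `deg L`, so that vanishing modulo `L`
    -- forces `Q = 0`.
    let Q : (AlgebraicClosure k)[X] := ∑ i : Fin r, ∑ s : Fin L.natDegree,
      C ((p i).coeff s) *
        φ.pairing L (SkewPolynomial.X ^ (i : ℕ)) ((X ^ (s : ℕ) : Fq[X]) • y)
    have hQdeg : Q.degree < L.natDegree := by
      refine (degree_sum_le _ _).trans_lt
        ((Finset.sup_lt_iff (WithBot.bot_lt_coe _)).2 fun i _ => ?_)
      refine (degree_sum_le _ _).trans_lt
        ((Finset.sup_lt_iff (WithBot.bot_lt_coe _)).2 fun s _ => ?_)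
      rw [← smul_eq_C_mul]
      exact (degree_smul_le _ _).trans_lt (φ.degree_pairing_lt L _ _)
    have hQmk : AdjoinRoot.mk (baseChange k L) Q = 0 := by
      rw [map_sum, ← hvy y hy]
      refine Finset.sum_congr rfl fun i _ => ?_
      rw [map_sum, ← hp, mk_eq_sum_of_degree_lt _ _ hd (hpd i), Finset.sum_mul]
      refine Finset.sum_congr rfl fun s _ => ?_
      rw [map_mul]
      change _ * φ.pairingMod L _ ((X ^ (s : ℕ) : Fq[X]) • y) = _
      rw [φ.pairingMod_smul_right L _ _ hy, reduceBase, RingHom.comp_apply, coe_mapRingHom,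
        Polynomial.map_pow, Polynomial.map_X, map_pow, mul_assoc]
    have hQ : Q = 0 := by
      rw [AdjoinRoot.mk_eq_zero] at hQmk
      exact eq_zero_of_dvd_of_degree_lt hQmk (hQdeg.trans_eq hdeg.symm)
    -- In degree `deg L - 1` the truncation of the monic `L` is `1`, so the coefficient of the
    -- pairing is the bare value of `w`.
    have hQc := congrArg (fun q => q.coeff (L.natDegree - 1)) hQ
    simp only [Q, finsetSum_coeff, coeff_C_mul, coeff_pairing, Polynomial.coeff_zero,
      if_pos (Nat.sub_lt hd zero_lt_one), Nat.sub_add_cancel hd, divX_iterate_natDegree,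
      hm.leadingCoeff, C_1, one_smul] at hQc
    exact hQc)
  funext i
  have hpi : p i = 0 := by
    ext s
    by_cases hs : s < L.natDegree
    · exact congrFun (congrFun hc i) ⟨s, hs⟩
    · rw [Polynomial.coeff_zero]
      exact coeff_eq_zero_of_degree_lt
        ((hpd i).trans_le (WithBot.coe_le_coe.2 (not_lt.1 hs)))
  rw [← hp, hpi, map_zero]
  rfl

/-- An injective `k̄`-linear endomorphism of a finite-dimensional space is surjective. -/
theorem isUnit_pairingMatrix {r : ℕ} (hr : 0 < r)
    (hΦ : tauDegree (φ.toAlgHom X) = r) (hm : L.Monic) (hd : 0 < L.natDegree)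
    (hL : aeval (SkewPolynomial.coeff (φ.toAlgHom X) 0) L ≠ 0)
    {e : Fin r → φ.Points} (he : ∀ j, L • e j = 0)
    (hspan : ∀ y : φ.Points, L • y = 0 → ∃ a : Fin r → Fq[X], ∑ j, a j • e j = y) :
    IsUnit (φ.pairingMatrix L e) := by
  rw [← Matrix.vecMul_surjective_iff_isUnit]
  have : Module.Finite (AlgebraicClosure k) (AdjoinRoot (baseChange k L)) :=
    (hm.map _).finite_adjoinRoot
  let f : (Fin r → AdjoinRoot (baseChange k L)) →ₗ[AlgebraicClosure k]
      (Fin r → AdjoinRoot (baseChange k L)) :=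
    (φ.pairingMatrix L e).vecMulLinear.restrictScalars (AlgebraicClosure k)
  have hinj : Function.Injective f := by
    rw [← LinearMap.ker_eq_bot, LinearMap.ker_eq_bot']
    exact fun v hv => eq_zero_of_vecMul_pairingMatrix hr hΦ hm hd hL he hspan v hv
  exact LinearMap.injective_iff_surjective.1 hinj

/-- The characteristic polynomial of `u` on the `L`-torsion is the reduction of the one of right
multiplication by `u` on `k{τ}`. -/
theorem dvd_coeff_charpoly_sub {r : ℕ} (hr : 0 < r)
    (hΦ : tauDegree (φ.toAlgHom X) = r) (hm : L.Monic) (hd : 0 < L.natDegree)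
    (hL : aeval (SkewPolynomial.coeff (φ.toAlgHom X) 0) L ≠ 0)
    {e : Fin r → φ.Points} (he : ∀ j, L • e j = 0)
    (hspan : ∀ y : φ.Points, L • y = 0 → ∃ a : Fin r → Fq[X], ∑ j, a j • e j = y)
    (u : φ.End) {W : Matrix (Fin r) (Fin r) Fq[X]}
    (hW : ∀ j, φ.endPoints u (e j) = ∑ i, W i j • e i) {P : Fq[X][X]}
    (hP : P.map (mapRingHom (algebraMap Fq (Coeff Fq k))) = (coordMatrix hr hΦ u.1).charpoly)
    (n : ℕ) : L ∣ P.coeff n - W.charpoly.coeff n := by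
  have h := charpoly_eq_of_mul_eq (isUnit_pairingMatrix hr hΦ hm hd hL he hspan)
    (coordMatrix_mul_pairingMatrix hr hΦ u he hW)
  rw [Matrix.charpoly_map, Matrix.charpoly_map, ← hP, Polynomial.map_map,
    reduceCoeff_comp_map] at h
  have hn := congrArg (fun p => p.coeff n) h
  simp only [Polynomial.coeff_map] at hn
  -- Divisibility of polynomials descends along the field extension from `Fq` to `k̄`.
  rw [reduceBase, RingHom.comp_apply, RingHom.comp_apply, AdjoinRoot.mk_eq_mk, ← map_sub,
    coe_mapRingHom, baseChange, map_dvd_map'] at hn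
  exact hn

end DrinfeldModule

/-! ### Passage to the completion -/

namespace Drinfeld

theorem evalₐ_of_val_eq {R : Type*} [CommRing R] {l : R} (a : Completion l) (n : ℕ) (r : R)
    (h : a.1 n = Submodule.Quotient.mk r) :
    AdicCompletion.evalₐ (Ideal.span {l}) n a = Ideal.Quotient.mk _ r := by
  rw [← AdicCompletion.factor_eval_eq_evalₐ _ a (Ideal.mul_top _).le]
  have h' : AdicCompletion.eval (Ideal.span {l}) R n a = Submodule.Quotient.mk r := h
  rw [h']
  rfl

/-- A nonzero `p` in the kernel would be divisible by `l ^ (deg p + 1)`, whose degree is too large.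
-/
theorem algebraMap_completion_injective {F : Type*} [Field F] {l : F[X]} (hl : Irreducible l) :
    Function.Injective (algebraMap F[X] (Completion l)) := by
  rw [injective_iff_map_eq_zero]
  intro p hp
  by_contra h0
  have h1 := congrArg (AdicCompletion.evalₐ (Ideal.span {l}) (p.natDegree + 1)) hp
  rw [map_zero, AlgHom.commutes, Ideal.Quotient.algebraMap_eq, Ideal.Quotient.eq_zero_iff_mem,
    Ideal.span_singleton_pow, Ideal.mem_span_singleton] at h1
  have h2 := natDegree_le_of_dvd h1 h0
  rw [natDegree_pow] at h2
  nlinarith [hl.natDegree_pos]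

theorem coord_map_eq_sum {R M ι : Type*} [CommRing R] [AddCommGroup M] [Module R M] [Fintype ι]
    [DecidableEq ι] {l : R} (b : Module.Basis ι (Completion l) (TateModule l M)) (f : M →ₗ[R] M)
    (n : ℕ) {W : Matrix ι ι R}
    (hW : ∀ i j, (LinearMap.toMatrix b b (tateMap l f) i j).1 n =
      Submodule.Quotient.mk (W i j)) (j : ι) :
    f ((b j).1 n) = ∑ i, W i j • (b i).1 n := by
  have h := congrArg (fun x => x.1 n) (b.sum_repr (tateMap l f (b j)))
  simp only [sum_coord] at h
  refine h.symm.trans (Finset.sum_congr rfl fun i _ => smul_coord _ _ _ _ ?_)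
  rw [← hW, LinearMap.toMatrix_apply]

end Drinfeld

theorem Polynomial.degree_neg_one_pow_mul {R : Type*} [Ring R] (n : ℕ) (p : R[X]) :
    ((-1) ^ n * p).degree = p.degree := by
  rcases neg_one_pow_eq_or R[X] n with h | h <;> rw [h] <;> simp

/-! ### Existence and uniqueness of `P` and of the determinant -/

namespace DrinfeldModule

open Drinfeld

variable {Fq k : Type*} [Field Fq] [Fintype Fq] [Field k] [Algebra Fq k]
variable {φ : DrinfeldModule Fq k}

theorem End.commute_X (u : φ.End) : Commute (φ.toAlgHom X) u.1 := End.commute φ u X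

theorem isCharpoly_of_map_eq (hr : 0 < φ.rank) (hΦ : tauDegree (φ.toAlgHom X) = φ.rank)
    (u : φ.End) {P : Fq[X][X]}
    (hP : P.map (mapRingHom (algebraMap Fq (Coeff Fq k))) = (coordMatrix hr hΦ u.1).charpoly) :
    φ.IsCharpoly u P := by
  intro l hm hirr hne
  obtain ⟨e, hspan, hindep⟩ := exists_tate_generators hr hΦ hm hirr hne
  refine ⟨tateBasis hspan hindep, ?_⟩
  have hb := tateBasis_apply hspan hindep
  generalize tateBasis hspan hindep = b at hb
  ext1 n
  -- Coefficients are compared modulo each `l^m`, where the matrix of `u` lifts to a matrix `W` over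
  -- `Fq[T]` describing `u` on `φ[l^m]`.
  refine AdicCompletion.ext_evalₐ fun m => ?_
  choose W hW using fun i j =>
    exists_rep (LinearMap.toMatrix b b (tateMap l (φ.endPoints u)) i j) m
  have hWm := fun i j => hW i j m le_rfl
  have hmap : (LinearMap.toMatrix b b (tateMap l (φ.endPoints u))).map
      (AdicCompletion.evalₐ (Ideal.span {l}) m : Completion l →+* _) =
        (Matrix.of W).map (Ideal.Quotient.mk (Ideal.span {l} ^ m)) := by
    ext i j
    exact evalₐ_of_val_eq _ _ _ (hWm i j)
  have hcp := congrArg (fun M => M.charpoly.coeff n) hmap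
  simp only [Matrix.charpoly_map, Polynomial.coeff_map] at hcp
  refine Eq.trans hcp ?_
  rw [Polynomial.coeff_map, AlgHom.commutes, Ideal.Quotient.algebraMap_eq, eq_comm,
    Ideal.Quotient.mk_eq_mk_iff_sub_mem, Ideal.span_singleton_pow, Ideal.mem_span_singleton]
  -- The comparison on `L`-torsion needs `deg L > 0`; level `0` is trivial.
  rcases Nat.eq_zero_or_pos m with rfl | hpos
  · rw [pow_zero]
    exact one_dvd _
  refine dvd_coeff_charpoly_sub hr hΦ (hm.pow m) ?_ ?_ (fun j => pow_smul_coord (e j) m)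
    (fun y hy => exists_sum_smul_coord hspan m hy) u (fun j => ?_) hP n
  · rw [natDegree_pow]
    exact Nat.mul_pos hpos hirr.natDegree_pos
  · rw [map_pow]
    exact pow_ne_zero _ (aeval_ne_zero_of_ne_characteristic φ hm hirr hne)
  · have := coord_map_eq_sum b (φ.endPoints u) m (W := Matrix.of W) hWm j
    simpa only [hb] using this

theorem exists_ne_characteristic (φ : DrinfeldModule Fq k) :
    ∃ l : Fq[X], l.Monic ∧ Irreducible l ∧ l ≠ φ.characteristic := by
  by_cases h : (X - C 0 : Fq[X]) = φ.characteristic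
  · refine ⟨X - C 1, monic_X_sub_C 1, irreducible_X_sub_C 1, fun h1 => ?_⟩
    exact zero_ne_one (C_injective (sub_right_injective (h.trans h1.symm)))
  · exact ⟨_, monic_X_sub_C 0, irreducible_X_sub_C 0, h⟩

/-- A single `l` suffices: the characteristic polynomial does not depend on the basis, and `Fq[T]`
embeds in the completion. -/
theorem IsCharpoly.unique {u : φ.End} {P P' : Fq[X][X]} (h : φ.IsCharpoly u P)
    (h' : φ.IsCharpoly u P') : P = P' := by
  obtain ⟨l, hm, hirr, hne⟩ := φ.exists_ne_characteristic
  obtain ⟨b, hb⟩ := h l hm hirr hne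
  obtain ⟨b', hb'⟩ := h' l hm hirr hne
  have : Module.Free (Completion l) (TateModule l φ.Points) := Module.Free.of_basis b
  have : Module.Finite (Completion l) (TateModule l φ.Points) := Module.Finite.of_basis b
  rw [LinearMap.charpoly_toMatrix] at hb hb'
  exact Polynomial.map_injective _ (algebraMap_completion_injective hirr) (hb.symm.trans hb')

theorem IsDet.unique {u : φ.End} {D D' : Fq[X]} (h : φ.IsDet u D) (h' : φ.IsDet u D') :
    D = D' := by
  obtain ⟨l, hm, hirr, hne⟩ := φ.exists_ne_characteristic
  obtain ⟨b, hb⟩ := h l hm hirr hne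
  obtain ⟨b', hb'⟩ := h' l hm hirr hne
  rw [LinearMap.det_toMatrix] at hb hb'
  exact algebraMap_completion_injective hirr (hb.symm.trans hb')

theorem IsCharpoly.isDet {u : φ.End} {P : Fq[X][X]} (h : φ.IsCharpoly u P) :
    φ.IsDet u ((-1) ^ φ.rank * P.coeff 0) := by
  intro l hm hirr hne
  obtain ⟨b, hb⟩ := h l hm hirr hne
  refine ⟨b, ?_⟩
  rw [Matrix.det_eq_sign_charpoly_coeff, hb, Polynomial.coeff_map, Fintype.card_fin, map_mul,
    map_pow, map_neg, map_one]

end DrinfeldModule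

end

theorem corollary3p4 {Fq k : Type*} [Field Fq] [Fintype Fq] [Field k] [Algebra Fq k]
    [FiniteDimensional Fq k] (φ : DrinfeldModule Fq k) (u : φ.End)
    (hu : Drinfeld.IsSeparable u.1) :
    (∃! P : Polynomial (Polynomial Fq), φ.IsCharpoly u P) ∧
    (∃! D : Polynomial Fq, φ.IsDet u D) ∧
    ∀ (P : Polynomial (Polynomial Fq)) (D : Polynomial Fq),
      φ.IsCharpoly u P → φ.IsDet u D →
        (P.eval 0).degree = D.degree ∧ D.degree = Drinfeld.tauDegree u.1 := by
  obtain ⟨r, hr, hΦ, rfl⟩ := φ.exists_tauDegree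
  obtain ⟨P₀, hP₀⟩ := Drinfeld.exists_charpoly_coordMatrix hr hΦ
    (DrinfeldModule.End.commute_X u)
  have hP := DrinfeldModule.isCharpoly_of_map_eq hr hΦ u hP₀
  refine ⟨⟨P₀, hP, fun P h => h.unique hP⟩, ⟨_, hP.isDet, fun D h => h.unique hP.isDet⟩, ?_⟩
  intro P D h h'
  rw [h.unique hP, h'.unique hP.isDet, degree_neg_one_pow_mul, ← coeff_zero_eq_eval_zero]
  refine ⟨rfl, ?_⟩
  -- Separability gives `u ≠ 0`, so its `τ`-degree is a natural number.
  have hu0 : u.1 ≠ 0 := by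
    intro h0
    rw [Drinfeld.IsSeparable, h0] at hu
    exact hu rfl
  obtain ⟨d, hd⟩ := WithBot.ne_bot_iff_exists.1 (mt Drinfeld.tauDegree_eq_bot.1 hu0)
  have hdet := Drinfeld.degree_det_coordMatrix hr hΦ hd.symm
  rw [Matrix.det_eq_sign_charpoly_coeff, degree_neg_one_pow_mul, ← hP₀, Polynomial.coeff_map,
    coe_mapRingHom, degree_map] at hdet
  exact hdet.trans hd
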